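/- By a *solution* of the first Painlevé equation $y''=6y^2-x$ we mean a real-valued solution $y(x)$ considered on its interval of existence, i.e. on a nonempty open interval of $\mathbb R$ beyond which it does not extend as a real-valued solution; two solutions are the same if their intervals of existence and their values there agree. Writing $y(a)=v$ for a solution includes that $a$ lies in its interval of existence. For real numbers $x_0\le 0$, $y_0$, $y^0$ put $$Z(x_0,y_0,y^0)=\inf\{z\in\mathbb R:\ \text{there is a solution } y \text{ of } y''=6y^2-x \text{ with } y(x_0)=y_0 \text{ and } y(z)=y^0\}.$$ **Theorem.** Let $x_0\le 0$ and $y_0,y^0\in\mathbb R$. The set above is nonempty and bounded below, so that $Z(x_0,y_0,y^0)$ is a real number, and $Z(x_0,y_0,y^0)<x_0$. Moreover, for every $x_1<x_0$, the Dirichlet boundary value problem $$y''=6y^2-x,\qquad y(x_0)=y_0,\quad y(x_1)=y^0$$ has 1. no solution if $x_1<Z(x_0,y_0,y^0)$; 2. exactly one solution if $x_1=Z(x_0,y_0,y^0)$; 3. exactly two solutions if $Z(x_0,y_0,y^0)<x_1<x_0$. -/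

import Mathlib

/-- `y` satisfies the first Painlevé equation `y'' = 6 y² - x` at every point of `s`. -/
def SatisfiesP1On (y : ℝ → ℝ) (s : Set ℝ) : Prop :=
  ∀ x ∈ s, DifferentiableAt ℝ y x ∧ HasDerivAt (deriv y) (6 * y x ^ 2 - x) x

/-- A real solution of `y'' = 6 y² - x`, given on its interval of existence: a nonempty open
interval `dom` beyond which it does not extend as a solution. The values of `toFun` outside `dom`
have no meaning; they are set to `0`, so that two solutions are equal exactly when their intervals
of existence and their values there coincide. -/
@[ext]
structure P1Solution where
  dom : Set ℝ
  toFun : ℝ → ℝ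
  isOpen_dom : IsOpen dom
  isConnected_dom : IsConnected dom
  eq_zero_off_dom : ∀ x ∉ dom, toFun x = 0
  satisfies : SatisfiesP1On toFun dom
  maximal : ∀ (s : Set ℝ) (w : ℝ → ℝ), IsOpen s → IsConnected s → dom ⊆ s →
    SatisfiesP1On w s → Set.EqOn w toFun dom → s ⊆ dom

/-- The solution `y` is defined at `x` and has the value `v` there. -/
def P1Solution.PassesThrough (y : P1Solution) (x v : ℝ) : Prop :=
  x ∈ y.dom ∧ y.toFun x = v

/-- The abscissas at which solutions with `y(x₀) = y₀` take the value `b`. -/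
def P1LevelAbscissas (x₀ y₀ b : ℝ) : Set ℝ :=
  {z | ∃ y : P1Solution, y.PassesThrough x₀ y₀ ∧ y.PassesThrough z b}

/-- The function `Z(x₀, y₀, b) = inf {z : y(z) = b}`, over all solutions with `y(x₀) = y₀`. -/
noncomputable def P1Z (x₀ y₀ b : ℝ) : ℝ :=
  sInf (P1LevelAbscissas x₀ y₀ b)

/-- The solutions of the Dirichlet problem `y(x₀) = y₀`, `y(x₁) = b`. -/
def P1DirichletSolutions (x₀ y₀ x₁ b : ℝ) : Set P1Solution :=
  {y | y.PassesThrough x₀ y₀ ∧ y.PassesThrough x₁ b}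

/-!
With `t = x₀ - x` and `c = -x₀ ≥ 0` the equation becomes `u'' = 6 u² + t + c`, whose right-hand side
is nonnegative and increasing in `t` for `t ≥ 0`; the solutions with `u 0 = y₀` are parametrised by
the slope `m = u' 0`.

Two such solutions meet at most once for `t > 0`: the Hamiltonian `v² / 2 - 2 u³ - (t + c) u` shows
that at a first meeting the sum of their derivatives is positive, and from there on the energy
`v² / 2 - 2 u³ - k u` with frozen `k` shows that the derivatives never agree again. Since the
Wronskian of the differences of three solutions is monotone, a solution whose slope lies between
those of two solutions of `u T = b` undershoots `b` at time `T`, so the problem has at most two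
solutions; if some solution undershoots, it has exactly two, because steep slopes of either sign
overshoot.

A priori bounds for solutions with `u T ≤ b` confine `(m, T)` to a compact set, so there is a last
time `T₀` at which the level `b` is reached. At `T₀` no solution undershoots, so there is only one.
At an earlier time `T`, the solution reaching `b` at `T₀`, started `T₀ - T` later and lowered a
little, is a strict subsolution, and some solution must come down to it; this one undershoots.
-/

open Set Filter Topology

/-! ### The linear equation `d'' = q d` -/

section LinearEquation

variable {d δ q : ℝ → ℝ} {a b C : ℝ}

theorem norm_cauchyData_le_mul_exp (hab : a ≤ b) (hd : ∀ t ∈ Icc a b, HasDerivAt d (δ t) t)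
    (hδ : ∀ t ∈ Icc a b, HasDerivAt δ (q t * d t) t) (hq : ∀ t ∈ Icc a b, |q t| ≤ C) :
    ‖(d b, δ b)‖ ≤ ‖(d a, δ a)‖ * Real.exp ((1 + C) * (b - a)) := by
  have hderiv : ∀ t ∈ Icc a b, HasDerivAt (fun t ↦ (d t, δ t)) (δ t, q t * d t) t :=
    fun t ht ↦ (hd t ht).prodMk (hδ t ht)
  have hbound : ∀ t ∈ Ico a b, ‖(δ t, q t * d t)‖ ≤ (1 + C) * ‖(d t, δ t)‖ + 0 := by
    intro t ht
    have hqt := hq t (Ico_subset_Icc_self ht)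
    have hC : 0 ≤ C := (abs_nonneg _).trans hqt
    simp only [Prod.norm_mk, Real.norm_eq_abs, add_zero]
    refine max_le ?_ ?_
    · nlinarith [le_max_right |d t| |δ t|, abs_nonneg (δ t)]
    · rw [abs_mul]
      nlinarith [le_max_left |d t| |δ t|, abs_nonneg (d t),
        mul_le_mul_of_nonneg_right hqt (abs_nonneg (d t))]
  rw [← gronwallBound_ε0]
  exact norm_le_gronwallBound_of_norm_deriv_right_le
    (fun t ht ↦ (hderiv t ht).continuousAt.continuousWithinAt)
    (fun t ht ↦ (hderiv t (Ico_subset_Icc_self ht)).hasDerivWithinAt) le_rfl hbound b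
    (right_mem_Icc.2 hab)

theorem cauchyData_eq_zero_of_left (hab : a ≤ b) (hd : ∀ t ∈ Icc a b, HasDerivAt d (δ t) t)
    (hδ : ∀ t ∈ Icc a b, HasDerivAt δ (q t * d t) t) (hq : ∀ t ∈ Icc a b, |q t| ≤ C)
    (hda : d a = 0) (hδa : δ a = 0) : d b = 0 ∧ δ b = 0 := by
  have h := norm_cauchyData_le_mul_exp hab hd hδ hq
  simpa [hda, hδa] using h

theorem cauchyData_eq_zero_iff (hab : a ≤ b) (hd : ∀ t ∈ Icc a b, HasDerivAt d (δ t) t)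
    (hδ : ∀ t ∈ Icc a b, HasDerivAt δ (q t * d t) t) (hq : ∀ t ∈ Icc a b, |q t| ≤ C) :
    (d a = 0 ∧ δ a = 0) ↔ (d b = 0 ∧ δ b = 0) := by
  refine ⟨fun h ↦ cauchyData_eq_zero_of_left hab hd hδ hq h.1 h.2, fun h ↦ ?_⟩
  have hneg : ∀ t ∈ Icc (-b) (-a), -t ∈ Icc a b := fun t ht ↦ ⟨le_neg.1 ht.2, neg_le.1 ht.1⟩
  have hreflected := cauchyData_eq_zero_of_left (d := fun t ↦ d (-t)) (δ := fun t ↦ -δ (-t))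
    (q := fun t ↦ q (-t)) (neg_le_neg hab)
    (fun t ht ↦ ((hd _ (hneg t ht)).scomp t (hasDerivAt_neg t)).congr_deriv (by simp))
    (fun t ht ↦ ((hδ _ (hneg t ht)).scomp t (hasDerivAt_neg t)).neg.congr_deriv (by simp))
    (fun t ht ↦ hq _ (hneg t ht)) (by simpa using h.1) (by simpa using h.2)
  simpa using hreflected

end LinearEquation

/-! ### The Cauchy problem for the first Painlevé equation -/

namespace SatisfiesP1On

variable {w y : ℝ → ℝ} {s t : Set ℝ}

theorem mono (h : SatisfiesP1On y t) (hst : s ⊆ t) : SatisfiesP1On y s :=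
  fun x hx ↦ h x (hst hx)

theorem of_hasDerivAt {g : ℝ → ℝ} (hs : IsOpen s) (hw : ∀ x ∈ s, HasDerivAt w (g x) x)
    (hg : ∀ x ∈ s, HasDerivAt g (6 * w x ^ 2 - x) x) : SatisfiesP1On w s := by
  intro x hx
  refine ⟨(hw x hx).differentiableAt, (hg x hx).congr_of_eventuallyEq ?_⟩
  filter_upwards [hs.mem_nhds hx] with z hz using (hw z hz).deriv

theorem congr (hs : IsOpen s) (hy : SatisfiesP1On y s) (h : EqOn w y s) : SatisfiesP1On w s := by
  intro x hx
  have hev : w =ᶠ[𝓝 x] y := h.eventuallyEq_of_mem (hs.mem_nhds hx)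
  refine ⟨(hy x hx).1.congr_of_eventuallyEq hev, ?_⟩
  rw [h hx]
  exact (hy x hx).2.congr_of_eventuallyEq hev.deriv

theorem hasDerivAt (hy : SatisfiesP1On y s) {x : ℝ} (hx : x ∈ s) : HasDerivAt y (deriv y x) x :=
  (hy x hx).1.hasDerivAt

theorem continuousOn (hy : SatisfiesP1On y s) : ContinuousOn y s :=
  fun _ hx ↦ (hy.hasDerivAt hx).continuousAt.continuousWithinAt

theorem cauchyData_eq_iff {a b : ℝ} (hab : a ≤ b) (hw : SatisfiesP1On w (Icc a b))
    (hy : SatisfiesP1On y (Icc a b)) :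
    (w a = y a ∧ deriv w a = deriv y a) ↔ (w b = y b ∧ deriv w b = deriv y b) := by
  have hcont : ContinuousOn (fun x ↦ 6 * (w x + y x)) (Icc a b) :=
    continuousOn_const.mul (hw.continuousOn.add hy.continuousOn)
  obtain ⟨C, hC⟩ := isCompact_Icc.exists_bound_of_continuousOn hcont
  have h := cauchyData_eq_zero_iff (d := fun x ↦ w x - y x)
    (δ := fun x ↦ deriv w x - deriv y x) (q := fun x ↦ 6 * (w x + y x)) hab
    (fun t ht ↦ (hw.hasDerivAt ht).sub (hy.hasDerivAt ht))
    (fun t ht ↦ ((hw t ht).2.sub (hy t ht).2).congr_deriv (by ring)) hC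
  simpa only [sub_eq_zero] using h

theorem eqOn_of_cauchyData_eq [hs : s.OrdConnected] (hw : SatisfiesP1On w s)
    (hy : SatisfiesP1On y s) {p : ℝ} (hp : p ∈ s) (hval : w p = y p)
    (hder : deriv w p = deriv y p) : EqOn w y s := by
  intro x hx
  rcases le_total p x with h | h
  · exact ((cauchyData_eq_iff h (hw.mono (hs.out hp hx)) (hy.mono (hs.out hp hx))).1
      ⟨hval, hder⟩).1
  · exact ((cauchyData_eq_iff h (hw.mono (hs.out hx hp)) (hy.mono (hs.out hx hp))).2
      ⟨hval, hder⟩).1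

end SatisfiesP1On

theorem satisfiesP1On_of_autonomous {α : ℝ → ℝ × ℝ × ℝ} {x ε : ℝ} (hε : 0 < ε)
    (hx : (α 0).1 = x)
    (hα : ∀ t ∈ Ioo (-ε) ε, HasDerivAt α (1, (α t).2.2, 6 * (α t).2.1 ^ 2 - (α t).1) t) :
    SatisfiesP1On (fun z ↦ (α (z - x)).2.1) (Ioo (x - ε) (x + ε)) ∧
      deriv (fun z ↦ (α (z - x)).2.1) x = (α 0).2.2 := by
  have hfst : ∀ t ∈ Ioo (-ε) ε, HasDerivAt (fun t ↦ (α t).1) 1 t := fun t ht ↦ (hα t ht).fst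
  have htime : EqOn (fun t ↦ (α t).1) (fun t ↦ t + x) (Ioo (-ε) ε) :=
    isOpen_Ioo.eqOn_of_deriv_eq isPreconnected_Ioo
      (fun t ht ↦ (hfst t ht).differentiableAt.differentiableWithinAt)
      (by fun_prop)
      (fun t ht ↦ by rw [(hfst t ht).deriv, ((hasDerivAt_id' t).add_const x).deriv])
      (x := 0) ⟨by linarith, hε⟩ (by simp [hx])
  have hmem : ∀ z ∈ Ioo (x - ε) (x + ε), z - x ∈ Ioo (-ε) ε :=
    fun z hz ↦ ⟨by linarith [hz.1], by linarith [hz.2]⟩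
  have hval : ∀ t ∈ Ioo (-ε) ε, HasDerivAt (fun t ↦ (α t).2.1) (α t).2.2 t :=
    fun t ht ↦ (hα t ht).snd.fst
  have hder : ∀ t ∈ Ioo (-ε) ε,
      HasDerivAt (fun t ↦ (α t).2.2) (6 * (α t).2.1 ^ 2 - (α t).1) t :=
    fun t ht ↦ (hα t ht).snd.snd
  refine ⟨SatisfiesP1On.of_hasDerivAt isOpen_Ioo
    (fun z hz ↦ (hval _ (hmem z hz)).comp_sub_const z x) fun z hz ↦ ?_, ?_⟩
  · have hz1 : (α (z - x)).1 = z := (htime (hmem z hz)).trans (sub_add_cancel z x)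
    exact ((hder _ (hmem z hz)).comp_sub_const z x).congr_deriv (by rw [hz1])
  · rw [((hval _ (hmem x ⟨by linarith, by linarith⟩)).comp_sub_const x x).deriv, sub_self]

theorem exists_satisfiesP1On_Ioo (x a v : ℝ) :
    ∃ r > 0, ∃ ε > 0, ∀ x' a' v' : ℝ, |x' - x| ≤ r → |a' - a| ≤ r → |v' - v| ≤ r →
      ∃ w : ℝ → ℝ, SatisfiesP1On w (Ioo (x' - ε) (x' + ε)) ∧ w x' = a' ∧ deriv w x' = v' := by
  let f : ℝ × ℝ × ℝ → ℝ × ℝ × ℝ := fun z ↦ (1, z.2.2, 6 * z.2.1 ^ 2 - z.1)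
  have hf : ContDiffAt ℝ 1 f (x, a, v) := ContDiff.contDiffAt (by fun_prop)
  obtain ⟨r, hr, ε, hε, H⟩ :=
    hf.exists_forall_mem_closedBall_exists_eq_forall_mem_Ioo_hasDerivAt 0
  refine ⟨r, hr, ε, hε, fun x' a' v' hx ha hv ↦ ?_⟩
  have hball : (x', a', v') ∈ Metric.closedBall (x, a, v) r := by
    simp only [Metric.mem_closedBall, Prod.dist_eq, Real.dist_eq, max_le_iff]
    exact ⟨hx, ha, hv⟩
  obtain ⟨α, hα0, hα⟩ := H _ hball
  rw [zero_sub, zero_add] at hα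
  obtain ⟨hw, hderiv⟩ := satisfiesP1On_of_autonomous hε (x := x') (by rw [hα0]) hα
  exact ⟨_, hw, by simp only [sub_self, hα0], by rw [hderiv, hα0]⟩

/-- `w` is a solution of the Cauchy problem `w p = a`, `w' p = v` on the open interval `s`; the
maximal solution is glued from these. -/
structure IsLocalP1Solution (p a v : ℝ) (s : Set ℝ) (w : ℝ → ℝ) : Prop where
  isOpen : IsOpen s
  isPreconnected : IsPreconnected s
  mem : p ∈ s
  satisfies : SatisfiesP1On w s
  apply_eq : w p = a
  deriv_eq : deriv w p = v

theorem exists_isLocalP1Solution (p a v : ℝ) : ∃ s w, IsLocalP1Solution p a v s w := by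
  obtain ⟨r, hr, ε, hε, H⟩ := exists_satisfiesP1On_Ioo p a v
  obtain ⟨w, hw, hval, hder⟩ := H p a v (by simpa using hr.le) (by simpa using hr.le)
    (by simpa using hr.le)
  exact ⟨_, w, isOpen_Ioo, isPreconnected_Ioo, ⟨by linarith, by linarith⟩, hw, hval, hder⟩

namespace IsLocalP1Solution

variable {p a v : ℝ} {s t : Set ℝ} {w z : ℝ → ℝ}

theorem eqOn_inter (hw : IsLocalP1Solution p a v s w) (hz : IsLocalP1Solution p a v t z) :
    EqOn w z (s ∩ t) := by
  have : (s ∩ t).OrdConnected :=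
    hw.isPreconnected.ordConnected.inter hz.isPreconnected.ordConnected
  exact SatisfiesP1On.eqOn_of_cauchyData_eq (hw.satisfies.mono inter_subset_left)
    (hz.satisfies.mono inter_subset_right) ⟨hw.mem, hz.mem⟩ (hw.apply_eq.trans hz.apply_eq.symm)
    (hw.deriv_eq.trans hz.deriv_eq.symm)

theorem congr (hw : IsLocalP1Solution p a v s w) (h : EqOn z w s) :
    IsLocalP1Solution p a v s z where
  __ := hw
  satisfies := hw.satisfies.congr hw.isOpen h
  apply_eq := (h hw.mem).trans hw.apply_eq
  deriv_eq := (h.eventuallyEq_of_mem (hw.isOpen.mem_nhds hw.mem)).deriv_eq.trans hw.deriv_eq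

theorem union (hw : IsLocalP1Solution p a v s w) (hz : IsLocalP1Solution p a v t w) :
    IsLocalP1Solution p a v (s ∪ t) w where
  __ := hw
  isOpen := hw.isOpen.union hz.isOpen
  isPreconnected := hw.isPreconnected.union p hw.mem hz.mem hz.isPreconnected
  mem := Or.inl hw.mem
  satisfies := fun x hx ↦ hx.elim (hw.satisfies x) (hz.satisfies x)

theorem exists_maximal (p a v : ℝ) : ∃ s w, IsLocalP1Solution p a v s w ∧ (∀ x ∉ s, w x = 0) ∧
    ∀ t z, IsLocalP1Solution p a v t z → t ⊆ s := by
  classical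
  let dom : Set ℝ := ⋃₀ {s | ∃ w, IsLocalP1Solution p a v s w}
  have hdom : ∀ x : ℝ, x ∈ dom → ∃ s w, IsLocalP1Solution p a v s w ∧ x ∈ s := by
    rintro x ⟨s, ⟨w, hw⟩, hx⟩
    exact ⟨s, w, hw, hx⟩
  choose! S W hSW hxS using hdom
  let f : ℝ → ℝ := fun x ↦ if x ∈ dom then W x x else 0
  have hsub : ∀ {s w}, IsLocalP1Solution p a v s w → s ⊆ dom :=
    fun {s w} h ↦ subset_sUnion_of_mem ⟨w, h⟩
  have hf : ∀ {s w}, IsLocalP1Solution p a v s w → IsLocalP1Solution p a v s f := by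
    intro s w h
    refine h.congr fun x hx ↦ ?_
    rw [show f x = W x x from if_pos (hsub h hx)]
    exact (hSW x (hsub h hx)).eqOn_inter h ⟨hxS x (hsub h hx), hx⟩
  obtain ⟨s₀, w₀, hw₀⟩ := exists_isLocalP1Solution p a v
  refine ⟨dom, f, ⟨?_, ?_, hsub hw₀ hw₀.mem, ?_, (hf hw₀).apply_eq, (hf hw₀).deriv_eq⟩,
    fun x hx ↦ if_neg hx, fun t z h ↦ hsub h⟩
  · exact isOpen_sUnion fun s ⟨_, hw⟩ ↦ hw.isOpen
  · exact isPreconnected_sUnion p _ (fun s ⟨_, hw⟩ ↦ hw.mem) (fun s ⟨_, hw⟩ ↦ hw.isPreconnected)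
  · exact fun x hx ↦ (hf (hSW x hx)).satisfies x (hxS x hx)

end IsLocalP1Solution

namespace P1Solution

theorem exists_isLocalP1Solution_dom (p a v : ℝ) :
    ∃ y : P1Solution, IsLocalP1Solution p a v y.dom y.toFun := by
  obtain ⟨s, w, hw, hzero, hmax⟩ := IsLocalP1Solution.exists_maximal p a v
  refine ⟨⟨s, w, hw.isOpen, ⟨⟨p, hw.mem⟩, hw.isPreconnected⟩, hzero, hw.satisfies, ?_⟩, hw⟩
  intro t z ht hconn hst hz heq
  refine hmax t z ⟨ht, hconn.isPreconnected, hst hw.mem, hz, ?_, ?_⟩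
  · exact (heq hw.mem).trans hw.apply_eq
  · exact (heq.eventuallyEq_of_mem (hw.isOpen.mem_nhds hw.mem)).deriv_eq.trans hw.deriv_eq

/-- The solution with the Cauchy data `y p = a`, `y' p = v`, on its interval of existence. -/
noncomputable def ofCauchyData (p a v : ℝ) : P1Solution :=
  (exists_isLocalP1Solution_dom p a v).choose

theorem ofCauchyData_spec (p a v : ℝ) :
    IsLocalP1Solution p a v (ofCauchyData p a v).dom (ofCauchyData p a v).toFun :=
  (exists_isLocalP1Solution_dom p a v).choose_spec

instance ordConnected_dom (y : P1Solution) : y.dom.OrdConnected :=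
  y.isConnected_dom.isPreconnected.ordConnected

theorem isLocalP1Solution (y : P1Solution) {p : ℝ} (hp : p ∈ y.dom) :
    IsLocalP1Solution p (y.toFun p) (deriv y.toFun p) y.dom y.toFun :=
  ⟨y.isOpen_dom, y.isConnected_dom.isPreconnected, hp, y.satisfies, rfl, rfl⟩

theorem subset_dom {y : P1Solution} {p a v : ℝ} {s : Set ℝ} {w : ℝ → ℝ}
    (hy : IsLocalP1Solution p a v y.dom y.toFun) (hw : IsLocalP1Solution p a v s w) :
    s ⊆ y.dom := by
  classical
  let g : ℝ → ℝ := y.dom.piecewise y.toFun w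
  have hgy : EqOn g y.toFun y.dom := piecewise_eqOn _ _ _
  have hgw : EqOn g w s := by
    intro x hx
    by_cases h : x ∈ y.dom
    · rw [hgy h, hy.eqOn_inter hw ⟨h, hx⟩]
    · exact piecewise_eq_of_notMem _ _ _ h
  have hg := (hw.congr hgw).union (hy.congr hgy)
  exact subset_union_left.trans (y.maximal (s ∪ y.dom) g hg.isOpen ⟨⟨p, hg.mem⟩, hg.isPreconnected⟩
    subset_union_right hg.satisfies hgy)

theorem eq_of_isLocalP1Solution {y z : P1Solution} {p a v : ℝ}
    (hy : IsLocalP1Solution p a v y.dom y.toFun) (hz : IsLocalP1Solution p a v z.dom z.toFun) :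
    y = z := by
  have hdom : y.dom = z.dom := (subset_dom hz hy).antisymm (subset_dom hy hz)
  refine P1Solution.ext hdom (funext fun x ↦ ?_)
  by_cases hx : x ∈ y.dom
  · exact hy.eqOn_inter hz ⟨hx, hdom ▸ hx⟩
  · rw [y.eq_zero_off_dom x hx, z.eq_zero_off_dom x (hdom ▸ hx)]

theorem eq_ofCauchyData (y : P1Solution) {p : ℝ} (hp : p ∈ y.dom) :
    y = ofCauchyData p (y.toFun p) (deriv y.toFun p) :=
  eq_of_isLocalP1Solution (y.isLocalP1Solution hp) (ofCauchyData_spec _ _ _)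

/-- The Cauchy data accumulate at a point near which solutions exist for a uniform time, so `y`
reaches every point of the closure of `s`. -/
theorem closure_subset_dom (y : P1Solution) {s : Set ℝ} {K : ℝ} (hs : s ⊆ y.dom)
    (hK : ∀ x ∈ s, |y.toFun x| ≤ K ∧ |deriv y.toFun x| ≤ K) : closure s ⊆ y.dom := by
  intro q hq
  obtain ⟨z, hzs, hz⟩ := mem_closure_iff_seq_limit.1 hq
  have hbox : IsCompact (Icc (-K) K ×ˢ Icc (-K) K) := isCompact_Icc.prod isCompact_Icc
  obtain ⟨⟨a, v⟩, -, φ, hφ, hlim⟩ := hbox.tendsto_subseq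
    (x := fun n ↦ (y.toFun (z n), deriv y.toFun (z n)))
    (fun n ↦ ⟨abs_le.1 (hK _ (hzs n)).1, abs_le.1 (hK _ (hzs n)).2⟩)
  obtain ⟨r, hr, ε, hε, H⟩ := exists_satisfiesP1On_Ioo q a v
  have hpos : ∀ᶠ n in atTop, |z (φ n) - q| < min r ε := by
    simpa only [Real.dist_eq, Function.comp_apply] using
      Metric.tendsto_nhds.1 (hz.comp hφ.tendsto_atTop) (min r ε) (lt_min hr hε)
  have hval : ∀ᶠ n in atTop, |y.toFun (z (φ n)) - a| < r :=
    Metric.tendsto_nhds.1 ((continuous_fst.tendsto _).comp hlim) r hr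
  have hder : ∀ᶠ n in atTop, |deriv y.toFun (z (φ n)) - v| < r :=
    Metric.tendsto_nhds.1 ((continuous_snd.tendsto _).comp hlim) r hr
  obtain ⟨n, hn, hvaln, hdern⟩ := (hpos.and (hval.and hder)).exists
  obtain ⟨hnr, hnε⟩ := lt_min_iff.1 hn
  obtain ⟨w, hw, hw0, hw1⟩ := H _ _ _ hnr.le hvaln.le hdern.le
  refine subset_dom (y.isLocalP1Solution (hs (hzs (φ n))))
    ⟨isOpen_Ioo, isPreconnected_Ioo, ⟨by linarith, by linarith⟩, hw, hw0, hw1⟩ ?_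
  exact ⟨by linarith [(abs_lt.1 hnε).2], by linarith [(abs_lt.1 hnε).1]⟩

end P1Solution

/-! ### Calculus on a compact interval -/

section Calculus

variable {u v g : ℝ → ℝ} {a b k r : ℝ}

theorem monotoneOn_Icc_of_hasDerivAt_nonneg (hu : ∀ t ∈ Icc a b, HasDerivAt u (v t) t)
    (hv : ∀ t ∈ Icc a b, 0 ≤ v t) : MonotoneOn u (Icc a b) :=
  monotoneOn_of_hasDerivWithinAt_nonneg (convex_Icc a b)
    (fun t ht ↦ (hu t ht).continuousAt.continuousWithinAt)
    (fun t ht ↦ (hu t (interior_subset ht)).hasDerivWithinAt)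
    (fun t ht ↦ hv t (interior_subset ht))

theorem lt_of_hasDerivAt_pos (hab : a < b) (hu : ∀ t ∈ Icc a b, HasDerivAt u (v t) t)
    (hv : ∀ t ∈ Ioo a b, 0 < v t) : u a < u b := by
  refine strictMonoOn_of_hasDerivWithinAt_pos (convex_Icc a b) (f' := v)
    (fun t ht ↦ (hu t ht).continuousAt.continuousWithinAt)
    (fun t ht ↦ (hu t (interior_subset ht)).hasDerivWithinAt) (fun t ht ↦ hv t ?_)
    (left_mem_Icc.2 hab.le) (right_mem_Icc.2 hab.le) hab
  rwa [interior_Icc] at ht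

theorem le_add_mul_sub (hab : a ≤ b) (hu : ∀ t ∈ Icc a b, HasDerivAt u (v t) t)
    (hv : ∀ t ∈ Icc a b, v t ≤ k) : u b ≤ u a + k * (b - a) := by
  have hmono := monotoneOn_Icc_of_hasDerivAt_nonneg (u := fun t ↦ k * t - u t)
    (fun t ht ↦ ((hasDerivAt_id' t).const_mul k).sub (hu t ht))
    (fun t ht ↦ by simpa using hv t ht)
  linarith [hmono (left_mem_Icc.2 hab) (right_mem_Icc.2 hab) hab]

theorem convexOn_sub_sq_of_le_deriv2 (hu : ∀ t ∈ Icc a b, HasDerivAt u (v t) t)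
    (hv : ∀ t ∈ Icc a b, HasDerivAt v (g t) t) (hg : ∀ t ∈ Icc a b, k ≤ g t) :
    ConvexOn ℝ (Icc a b) (fun t ↦ u t - k / 2 * t ^ 2) := by
  have hderiv : ∀ t ∈ Icc a b, HasDerivAt (fun t ↦ u t - k / 2 * t ^ 2) (v t - k * t) t :=
    fun t ht ↦ ((hu t ht).sub ((hasDerivAt_pow 2 t).const_mul (k / 2))).congr_deriv
      (by push_cast; ring)
  refine convexOn_of_hasDerivWithinAt2_nonneg (convex_Icc a b)
    (f' := fun t ↦ v t - k * t) (f'' := fun t ↦ g t - k)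
    (fun t ht ↦ (hderiv t ht).continuousAt.continuousWithinAt)
    (fun t ht ↦ (hderiv t (interior_subset ht)).hasDerivWithinAt) (fun t ht ↦ ?_)
    (fun t ht ↦ sub_nonneg.2 (hg t (interior_subset ht)))
  exact (((hv t (interior_subset ht)).sub ((hasDerivAt_id' t).const_mul k)).congr_deriv
    (by ring)).hasDerivWithinAt

theorem convexOn_of_deriv2_nonneg_Icc (hu : ∀ t ∈ Icc a b, HasDerivAt u (v t) t)
    (hv : ∀ t ∈ Icc a b, HasDerivAt v (g t) t) (hg : ∀ t ∈ Icc a b, 0 ≤ g t) :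
    ConvexOn ℝ (Icc a b) u := by
  simpa using convexOn_sub_sq_of_le_deriv2 hu hv hg

theorem add_mul_add_sq_le_of_le_deriv2 (hab : a < b) (hu : ∀ t ∈ Icc a b, HasDerivAt u (v t) t)
    (hv : ∀ t ∈ Icc a b, HasDerivAt v (g t) t) (hg : ∀ t ∈ Icc a b, k ≤ g t) :
    u a + v a * (b - a) + k / 2 * (b - a) ^ 2 ≤ u b := by
  have ha : a ∈ Icc a b := left_mem_Icc.2 hab.le
  have hderiv : HasDerivAt (fun t ↦ u t - k / 2 * t ^ 2) (v a - k * a) a :=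
    ((hu a ha).sub ((hasDerivAt_pow 2 a).const_mul (k / 2))).congr_deriv (by push_cast; ring)
  have hslope := (convexOn_sub_sq_of_le_deriv2 hu hv hg).le_slope_of_hasDerivAt ha
    (right_mem_Icc.2 hab.le) hab hderiv
  rw [slope_def_field, le_div_iff₀ (sub_pos.2 hab)] at hslope
  linarith

theorem midpoint_add_sq_le_of_le_deriv2 (hab : a ≤ b)
    (hu : ∀ t ∈ Icc a b, HasDerivAt u (v t) t)
    (hv : ∀ t ∈ Icc a b, HasDerivAt v (g t) t) (hg : ∀ t ∈ Icc a b, k ≤ g t) :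
    u ((a + b) / 2) + k / 8 * (b - a) ^ 2 ≤ (u a + u b) / 2 := by
  have hmid := (convexOn_sub_sq_of_le_deriv2 hu hv hg).2 (left_mem_Icc.2 hab)
    (right_mem_Icc.2 hab) one_half_pos.le one_half_pos.le (add_halves 1)
  simp only [smul_eq_mul] at hmid
  rw [show 1 / 2 * a + 1 / 2 * b = (a + b) / 2 by ring] at hmid
  linarith

theorem exists_first_zero (hab : a < b) (hc : ContinuousOn u (Icc a b))
    (hev : ∀ᶠ t in 𝓝[>] a, 0 < u t) (hb : u b ≤ 0) :
    ∃ t₀ ∈ Ioc a b, u t₀ = 0 ∧ ∀ t ∈ Ioo a t₀, 0 < u t := by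
  obtain ⟨r, hr, hpos⟩ := mem_nhdsGT_iff_exists_Ioo_subset.1 hev
  have hrb : r ≤ b := le_of_not_gt fun h ↦ hb.not_gt (hpos ⟨hab, h⟩)
  obtain ⟨p, hap, hpr⟩ := exists_between (mem_Ioi.1 hr)
  have hcp : ContinuousOn u (Icc p b) := hc.mono (Icc_subset_Icc_left hap.le)
  have hcompact : IsCompact (Icc p b ∩ u ⁻¹' Iic 0) :=
    isCompact_Icc.of_isClosed_subset (hcp.preimage_isClosed_of_isClosed isClosed_Icc isClosed_Iic)
      inter_subset_left
  obtain ⟨t₀, ⟨ht₀, hut₀⟩, hleast⟩ :=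
    hcompact.exists_isLeast ⟨b, ⟨(hpr.trans_le hrb).le, le_rfl⟩, hb⟩
  refine ⟨t₀, ⟨hap.trans_le ht₀.1, ht₀.2⟩, ?_, fun t ht ↦ ?_⟩
  · obtain ⟨z, hz, huz⟩ := intermediate_value_Icc' ht₀.1
      (hcp.mono (Icc_subset_Icc_right ht₀.2)) ⟨hut₀, (hpos ⟨hap, hpr⟩).le⟩
    rwa [hz.2.antisymm (hleast ⟨⟨hz.1, hz.2.trans ht₀.2⟩, huz.le⟩)] at huz
  · rcases le_or_gt p t with hpt | htp
    · by_contra! hut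
      exact ht.2.not_ge (hleast ⟨⟨hpt, ht.2.le.trans ht₀.2⟩, hut⟩)
    · exact hpos ⟨ht.1, htp.trans hpr⟩

theorem nonneg_Icc_of_pos_Ioo (ha : 0 ≤ u a) (hb : 0 ≤ u b) (hpos : ∀ t ∈ Ioo a b, 0 < u t) :
    ∀ t ∈ Icc a b, 0 ≤ u t := by
  intro t ht
  rcases ht.1.eq_or_lt with rfl | hat
  · exact ha
  rcases ht.2.eq_or_lt with rfl | htb
  · exact hb
  · exact (hpos t ⟨hat, htb⟩).le

theorem eventually_nhdsGT_pos_of_deriv_pos (h : HasDerivAt u r a) (ha : u a = 0) (hr : 0 < r) :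
    ∀ᶠ t in 𝓝[>] a, 0 < u t := by
  have hslope := (hasDerivWithinAt_iff_tendsto_slope' self_notMem_Ioi).1
    (h.hasDerivWithinAt (s := Ioi a))
  filter_upwards [hslope.eventually (lt_mem_nhds hr), self_mem_nhdsWithin] with t ht hat
  rw [slope_def_field, ha, sub_zero] at ht
  exact (div_pos_iff_of_pos_right (sub_pos.2 hat)).1 ht

theorem deriv_nonneg_of_pos_right (hab : a < b) (h : HasDerivAt u r a) (ha : u a = 0)
    (hpos : ∀ t ∈ Ioo a b, 0 < u t) : 0 ≤ r := by
  refine ge_of_tendsto ((hasDerivWithinAt_iff_tendsto_slope' self_notMem_Ioi).1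
    (h.hasDerivWithinAt (s := Ioi a))) ?_
  filter_upwards [Ioo_mem_nhdsGT hab] with t ht
  rw [slope_def_field, ha, sub_zero]
  exact div_nonneg (hpos t ht).le (sub_nonneg.2 ht.1.le)

theorem deriv_nonpos_of_pos_left (hab : a < b) (h : HasDerivAt u r b) (hb : u b = 0)
    (hpos : ∀ t ∈ Ioo a b, 0 < u t) : r ≤ 0 := by
  refine le_of_tendsto ((hasDerivWithinAt_iff_tendsto_slope' self_notMem_Iio).1
    (h.hasDerivWithinAt (s := Iio b))) ?_
  filter_upwards [Ioo_mem_nhdsLT hab] with t ht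
  rw [slope_def_field, hb, sub_zero]
  exact div_nonpos_of_nonneg_of_nonpos (hpos t ht).le (sub_nonpos.2 ht.2.le)

/-- Either `u` stays so negative that `u''` pushes it up too fast, or the chord overshoots. -/
theorem neg_max_le_of_six_mul_sq_le (hab : a < b) (hu : ∀ t ∈ Icc a b, HasDerivAt u (v t) t)
    (hv : ∀ t ∈ Icc a b, HasDerivAt v (g t) t) (hg : ∀ t ∈ Icc a b, 6 * u t ^ 2 ≤ g t)
    (hva : 0 ≤ v a) : -max (16 / (b - a) ^ 2) (u b) ≤ u a := by
  by_contra! hlt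
  obtain ⟨M, hM⟩ : ∃ M, u a = -M := ⟨-u a, (neg_neg _).symm⟩
  obtain ⟨h, rfl⟩ : ∃ h, b = a + 4 * h := ⟨(b - a) / 4, by ring⟩
  rw [hM, neg_lt_neg_iff, max_lt_iff] at hlt
  have hh : 0 < h := by linarith
  have hMh : 1 < M * h ^ 2 := by
    have h16 := (div_lt_iff₀ (by nlinarith)).1 hlt.1
    linarith
  have hM0 : 0 < M := pos_of_mul_pos_left (one_pos.trans hMh) (sq_nonneg h)
  have hgnn : ∀ t ∈ Icc a (a + 4 * h), 0 ≤ g t := fun t ht ↦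
    (by positivity : (0 : ℝ) ≤ 6 * u t ^ 2).trans (hg t ht)
  have ha : a ∈ Icc a (a + 4 * h) := left_mem_Icc.2 hab.le
  have hvnn : ∀ t ∈ Icc a (a + 4 * h), 0 ≤ v t := fun t ht ↦
    hva.trans (monotoneOn_Icc_of_hasDerivAt_nonneg hv hgnn ha ht ht.1)
  have hmono := monotoneOn_Icc_of_hasDerivAt_nonneg hu hvnn
  have hsub : Icc a (a + h) ⊆ Icc a (a + 4 * h) := Icc_subset_Icc_right (by linarith)
  have hah : a + h ∈ Icc a (a + h) := right_mem_Icc.2 (by linarith)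
  have hchord := (convexOn_of_deriv2_nonneg_Icc hu hv hgnn).secant_mono_aux1 ha
    (right_mem_Icc.2 hab.le) (y := a + h) (by linarith) (by linarith)
  have hhalf : u (a + h) ≤ -(M / 2) := by
    refine le_of_mul_le_mul_left ?_ hh
    nlinarith [hlt.2]
  have hgM : ∀ t ∈ Icc a (a + h), 3 / 2 * M ^ 2 ≤ g t := fun t ht ↦ by
    nlinarith [hg t (hsub ht), hmono (hsub ht) (hsub hah) ht.2]
  have hquad := add_mul_add_sq_le_of_le_deriv2 (by linarith) (fun t ht ↦ hu t (hsub ht))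
    (fun t ht ↦ hv t (hsub ht)) hgM
  nlinarith [mul_nonneg hva hh.le, mul_lt_mul_of_pos_left hMh hM0]

/-- The bound is obtained on the half of the interval on which `u` is increasing away from the
midpoint. -/
theorem neg_max_le_midpoint_of_six_mul_sq_le (hab : a < b)
    (hu : ∀ t ∈ Icc a b, HasDerivAt u (v t) t) (hv : ∀ t ∈ Icc a b, HasDerivAt v (g t) t)
    (hg : ∀ t ∈ Icc a b, 6 * u t ^ 2 ≤ g t) :
    -max (64 / (b - a) ^ 2) (max (u a) (u b)) ≤ u ((a + b) / 2) := by
  obtain ⟨p, hp⟩ : ∃ p, p = (a + b) / 2 := ⟨_, rfl⟩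
  rw [← hp]
  have hscale : 16 / ((b - a) / 2) ^ 2 = 64 / (b - a) ^ 2 := by
    rw [div_pow, div_div_eq_mul_div]
    norm_num
  rcases le_total 0 (v p) with hvp | hvp
  · have hsub : Icc p b ⊆ Icc a b := Icc_subset_Icc_left (by linarith)
    have hright := neg_max_le_of_six_mul_sq_le (by linarith) (fun t ht ↦ hu t (hsub ht))
      (fun t ht ↦ hv t (hsub ht)) (fun t ht ↦ hg t (hsub ht)) hvp
    rw [show b - p = (b - a) / 2 by rw [hp]; ring, hscale] at hright
    exact (neg_le_neg (max_le_max le_rfl (le_max_right _ _))).trans hright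
  · have hsub : ∀ t ∈ Icc (-p) (-a), -t ∈ Icc a b :=
      fun t ht ↦ ⟨by linarith [ht.2], by linarith [ht.1]⟩
    have hleft := neg_max_le_of_six_mul_sq_le (a := -p) (b := -a) (u := fun t ↦ u (-t))
      (v := fun t ↦ -v (-t)) (g := fun t ↦ g (-t)) (by linarith)
      (fun t ht ↦ ((hu _ (hsub t ht)).scomp t (hasDerivAt_neg t)).congr_deriv (by simp))
      (fun t ht ↦ ((hv _ (hsub t ht)).scomp t (hasDerivAt_neg t)).neg.congr_deriv (by simp))
      (fun t ht ↦ hg _ (hsub t ht)) (by simpa using hvp)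
    rw [show -a - -p = (b - a) / 2 by rw [hp]; ring, hscale, neg_neg, neg_neg] at hleft
    exact (neg_le_neg (max_le_max le_rfl (le_max_left _ _))).trans hleft

end Calculus

/-! ### The reflected equation `u'' = 6 u² + t + c` -/

/-- `u` satisfies `u'' = 6 u² + t + c` on `s`, with derivative `v`. If `y'' = 6 y² - x`, then
`u t = y (x₀ - t)` is of this kind with `c = -x₀`. -/
structure IsReflectedP1On (c : ℝ) (u v : ℝ → ℝ) (s : Set ℝ) : Prop where
  hasDerivAt : ∀ t ∈ s, HasDerivAt u (v t) t
  hasDerivAt_deriv : ∀ t ∈ s, HasDerivAt v (6 * u t ^ 2 + t + c) t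

namespace IsReflectedP1On

variable {c a b t : ℝ} {u v u₁ v₁ u₂ v₂ : ℝ → ℝ} {s : Set ℝ}

theorem mono {s' : Set ℝ} (h : IsReflectedP1On c u v s) (hs : s' ⊆ s) :
    IsReflectedP1On c u v s' :=
  ⟨fun t ht ↦ h.hasDerivAt t (hs ht), fun t ht ↦ h.hasDerivAt_deriv t (hs ht)⟩

theorem continuousOn (h : IsReflectedP1On c u v s) : ContinuousOn u s :=
  fun t ht ↦ (h.hasDerivAt t ht).continuousAt.continuousWithinAt

theorem continuousOn_deriv (h : IsReflectedP1On c u v s) : ContinuousOn v s :=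
  fun t ht ↦ (h.hasDerivAt_deriv t ht).continuousAt.continuousWithinAt

theorem convexOn (ha : 0 ≤ a + c) (h : IsReflectedP1On c u v (Icc a b)) :
    ConvexOn ℝ (Icc a b) u :=
  convexOn_of_deriv2_nonneg_Icc h.hasDerivAt h.hasDerivAt_deriv
    fun t ht ↦ by nlinarith [sq_nonneg (u t), ht.1]

theorem monotoneOn_deriv (ha : 0 ≤ a + c) (h : IsReflectedP1On c u v (Icc a b)) :
    MonotoneOn v (Icc a b) :=
  monotoneOn_Icc_of_hasDerivAt_nonneg h.hasDerivAt_deriv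
    fun t ht ↦ by nlinarith [sq_nonneg (u t), ht.1]

/-- The Hamiltonian of the equation, `H = v² / 2 - 2 u³ - (t + c) u`, satisfies `H' = -u`; with the
coefficient of `u` frozen at the value `k` one gets this identity instead. -/
theorem hasDerivAt_energy (k : ℝ) (h : IsReflectedP1On c u v s) (ht : t ∈ s) :
    HasDerivAt (fun t ↦ v t ^ 2 / 2 - 2 * u t ^ 3 - k * u t) ((t + c - k) * v t) t := by
  have hu := h.hasDerivAt t ht
  refine (((((h.hasDerivAt_deriv t ht).pow 2).div_const 2).sub ((hu.pow 3).const_mul 2)).sub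
    (hu.const_mul k)).congr_deriv ?_
  simp only [Nat.cast_ofNat, Nat.add_one_sub_one, pow_one]
  ring

theorem hasDerivAt_hamiltonian (h : IsReflectedP1On c u v s) (ht : t ∈ s) :
    HasDerivAt (fun t ↦ v t ^ 2 / 2 - 2 * u t ^ 3 - (t + c) * u t) (-u t) t := by
  have hu := h.hasDerivAt t ht
  refine (((((h.hasDerivAt_deriv t ht).pow 2).div_const 2).sub ((hu.pow 3).const_mul 2)).sub
    (((hasDerivAt_id' t).add_const c).mul hu)).congr_deriv ?_
  simp only [Nat.cast_ofNat, Nat.add_one_sub_one, pow_one]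
  ring

theorem deriv_lt_of_eq_of_deriv_lt (ha : 0 ≤ a + c) (h₁ : IsReflectedP1On c u₁ v₁ (Icc a b))
    (h₂ : IsReflectedP1On c u₂ v₂ (Icc a b)) (heq : u₂ a = u₁ a) (hlt : v₂ a < v₁ a)
    (hmean : 0 < v₁ a + v₂ a) : ∀ t ∈ Icc a b, v₂ t < v₁ t := by
  by_contra! hcon
  obtain ⟨r, hr, hvr⟩ := hcon
  have har : a < r := hr.1.lt_of_ne fun h ↦ by rw [← h] at hvr; linarith
  have hvc : ContinuousOn (fun t ↦ v₁ t - v₂ t) (Icc a b) :=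
    h₁.continuousOn_deriv.sub h₂.continuousOn_deriv
  have haI : a ∈ Icc a b := left_mem_Icc.2 (hr.1.trans hr.2)
  have hva : ∀ᶠ t in 𝓝[>] a, 0 < v₁ t - v₂ t :=
    (((h₁.hasDerivAt_deriv a haI).sub (h₂.hasDerivAt_deriv a haI)).continuousAt.eventually
      (lt_mem_nhds (sub_pos.2 hlt))).filter_mono nhdsWithin_le_nhds
  obtain ⟨t₀, ht₀, hv₀, hpos⟩ := exists_first_zero har (hvc.mono (Icc_subset_Icc_right hr.2)) hva
    (sub_nonpos.2 hvr)
  have hsub : Icc a t₀ ⊆ Icc a b := Icc_subset_Icc_right (ht₀.2.trans hr.2)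
  have hu₀ : u₂ t₀ < u₁ t₀ := by
    have hdiff := lt_of_hasDerivAt_pos ht₀.1
      (fun t ht ↦ (h₁.hasDerivAt t (hsub ht)).sub (h₂.hasDerivAt t (hsub ht))) hpos
    simp only [Pi.sub_apply] at hdiff
    linarith
  have henergy := lt_of_hasDerivAt_pos ht₀.1
    (fun t ht ↦ (h₁.hasDerivAt_energy (a + c) (hsub ht)).sub
      (h₂.hasDerivAt_energy (a + c) (hsub ht)))
    (fun t ht ↦ by nlinarith [hpos t ht, ht.1])
  have hcube : u₂ t₀ ^ 3 < u₁ t₀ ^ 3 := (Odd.strictMono_pow (by decide)) hu₀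
  simp only [Pi.sub_apply, heq, sub_eq_zero.1 hv₀] at henergy
  nlinarith [mul_pos (sub_pos.2 hlt) hmean, mul_nonneg ha (sub_pos.2 hu₀).le]

theorem deriv_add_deriv_pos_of_consecutive_meetings (hab : a < b) (ha : 0 ≤ a + c)
    (h₁ : IsReflectedP1On c u₁ v₁ (Icc a b)) (h₂ : IsReflectedP1On c u₂ v₂ (Icc a b))
    (heqa : u₂ a = u₁ a) (heqb : u₂ b = u₁ b) (hlt : ∀ t ∈ Ioo a b, u₂ t < u₁ t) :
    0 < v₁ b + v₂ b := by
  by_contra! hmean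
  have haI : a ∈ Icc a b := left_mem_Icc.2 hab.le
  have hbI : b ∈ Icc a b := right_mem_Icc.2 hab.le
  have hva : 0 ≤ v₁ a - v₂ a :=
    deriv_nonneg_of_pos_right hab ((h₁.hasDerivAt a haI).sub (h₂.hasDerivAt a haI))
      (sub_eq_zero.2 heqa.symm) fun t ht ↦ sub_pos.2 (hlt t ht)
  have hvb : v₁ b - v₂ b ≤ 0 :=
    deriv_nonpos_of_pos_left hab ((h₁.hasDerivAt b hbI).sub (h₂.hasDerivAt b hbI))
      (sub_eq_zero.2 heqb.symm) fun t ht ↦ sub_pos.2 (hlt t ht)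
  have hmeana : v₁ a + v₂ a ≤ 0 :=
    (add_le_add (h₁.monotoneOn_deriv ha haI hbI hab.le)
      (h₂.monotoneOn_deriv ha haI hbI hab.le)).trans hmean
  have henergy := lt_of_hasDerivAt_pos hab
    (fun t ht ↦ (h₂.hasDerivAt_hamiltonian ht).sub (h₁.hasDerivAt_hamiltonian ht))
    (fun t ht ↦ by linarith [hlt t ht])
  simp only [Pi.sub_apply, heqa, heqb] at henergy
  nlinarith [mul_nonneg_of_nonpos_of_nonpos hmean hvb, mul_nonpos_of_nonpos_of_nonneg hmeana hva]

theorem deriv_ne_of_eq (hab : a ≤ b) (h₁ : IsReflectedP1On c u₁ v₁ (Icc a b))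
    (h₂ : IsReflectedP1On c u₂ v₂ (Icc a b)) (heq : u₂ b = u₁ b) (hne : v₂ a ≠ v₁ a) :
    v₂ b ≠ v₁ b := by
  intro hvb
  obtain ⟨C, hC⟩ := isCompact_Icc.exists_bound_of_continuousOn
    (f := fun t ↦ 6 * (u₂ t + u₁ t))
    (continuousOn_const.mul (h₂.continuousOn.add h₁.continuousOn))
  have hiff := cauchyData_eq_zero_iff (d := fun t ↦ u₂ t - u₁ t) (δ := fun t ↦ v₂ t - v₁ t) hab
    (fun t ht ↦ (h₂.hasDerivAt t ht).sub (h₁.hasDerivAt t ht))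
    (fun t ht ↦ ((h₂.hasDerivAt_deriv t ht).sub (h₁.hasDerivAt_deriv t ht)).congr_deriv
      (by ring)) hC
  exact hne (sub_eq_zero.1 (hiff.2 ⟨sub_eq_zero.2 heq, sub_eq_zero.2 hvb⟩).2)

theorem lt_after_second_meeting {p : ℝ} (ha : 0 ≤ a + c) (hp : p ∈ Ioc a b)
    (h₁ : IsReflectedP1On c u₁ v₁ (Icc a b)) (h₂ : IsReflectedP1On c u₂ v₂ (Icc a b))
    (heqa : u₂ a = u₁ a) (hne : v₂ a ≠ v₁ a) (heqp : u₂ p = u₁ p)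
    (hlt : ∀ t ∈ Ioo a p, u₂ t < u₁ t) : ∀ t ∈ Ioc p b, u₁ t < u₂ t := by
  intro r hr
  have hleft : Icc a p ⊆ Icc a b := Icc_subset_Icc_right hp.2
  have hright : Icc p b ⊆ Icc a b := Icc_subset_Icc_left hp.1.le
  have hpI : p ∈ Icc a b := ⟨hp.1.le, hp.2⟩
  have hvp : v₁ p < v₂ p := by
    have hle := deriv_nonpos_of_pos_left hp.1
      ((h₁.hasDerivAt p hpI).sub (h₂.hasDerivAt p hpI)) (sub_eq_zero.2 heqp.symm)
      fun t ht ↦ sub_pos.2 (hlt t ht)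
    exact (sub_nonpos.1 hle).lt_of_ne
      (deriv_ne_of_eq hp.1.le (h₁.mono hleft) (h₂.mono hleft) heqp hne).symm
  have hmean := deriv_add_deriv_pos_of_consecutive_meetings hp.1 ha (h₁.mono hleft)
    (h₂.mono hleft) heqa heqp hlt
  have hv := deriv_lt_of_eq_of_deriv_lt (by linarith [hp.1]) (h₂.mono hright) (h₁.mono hright)
    heqp.symm hvp (by linarith)
  have hdiff := lt_of_hasDerivAt_pos hr.1
    (fun t ht ↦ (h₂.hasDerivAt t (hright ⟨ht.1, ht.2.trans hr.2⟩)).sub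
      (h₁.hasDerivAt t (hright ⟨ht.1, ht.2.trans hr.2⟩)))
    (fun t ht ↦ sub_pos.2 (hv t ⟨ht.1.le, ht.2.le.trans hr.2⟩))
  simp only [Pi.sub_apply, heqp] at hdiff
  linarith

theorem exists_first_meeting (ha : 0 ≤ a + c) (h₁ : IsReflectedP1On c u₁ v₁ (Icc a b))
    (h₂ : IsReflectedP1On c u₂ v₂ (Icc a b)) (heq : u₂ a = u₁ a) (hlt : v₂ a < v₁ a)
    (ht : t ∈ Ioc a b) (hle : u₁ t ≤ u₂ t) :
    ∃ p ∈ Ioc a t, u₁ p = u₂ p ∧ (∀ r ∈ Ioo a p, u₂ r < u₁ r) ∧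
      ∀ r ∈ Ioc p b, u₁ r < u₂ r := by
  have haI : a ∈ Icc a b := left_mem_Icc.2 (ht.1.le.trans ht.2)
  have hcont : ContinuousOn (fun t ↦ u₁ t - u₂ t) (Icc a b) := h₁.continuousOn.sub h₂.continuousOn
  obtain ⟨p, hp, hzero, hpos⟩ := exists_first_zero ht.1 (hcont.mono (Icc_subset_Icc_right ht.2))
    (eventually_nhdsGT_pos_of_deriv_pos ((h₁.hasDerivAt a haI).sub (h₂.hasDerivAt a haI))
      (sub_eq_zero.2 heq.symm) (sub_pos.2 hlt)) (sub_nonpos.2 hle)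
  have hbefore : ∀ r ∈ Ioo a p, u₂ r < u₁ r := fun r hr ↦ sub_pos.1 (hpos r hr)
  exact ⟨p, hp, sub_eq_zero.1 hzero, hbefore, lt_after_second_meeting ha ⟨hp.1, hp.2.trans ht.2⟩
    h₁ h₂ heq hlt.ne (sub_eq_zero.1 hzero).symm hbefore⟩

theorem lt_of_eq_of_eq (ha : 0 ≤ a + c) (h₁ : IsReflectedP1On c u₁ v₁ (Icc a b))
    (h₂ : IsReflectedP1On c u₂ v₂ (Icc a b)) (heqa : u₂ a = u₁ a) (hlt : v₂ a < v₁ a)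
    (heqb : u₂ b = u₁ b) : ∀ t ∈ Ioo a b, u₂ t < u₁ t := by
  intro t ht
  by_contra! hle
  obtain ⟨p, hp, -, -, hafter⟩ := exists_first_meeting ha h₁ h₂ heqa hlt ⟨ht.1, ht.2.le⟩ hle
  exact (hafter b ⟨hp.2.trans_lt ht.2, le_rfl⟩).ne' heqb

/-- The Wronskian of the differences `u - u₂` and `u₁ - u` is strictly increasing, which forbids
that it ends up with the sign it has at a first meeting of `u` and `u₁`. -/
theorem ne_of_ordered (hab : a < b) (h₁ : IsReflectedP1On c u₁ v₁ (Icc a b))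
    (h : IsReflectedP1On c u v (Icc a b)) (h₂ : IsReflectedP1On c u₂ v₂ (Icc a b))
    (heq₁ : u a = u₁ a) (heq₂ : u₂ a = u a) (hlt₁ : ∀ t ∈ Ioo a b, u t < u₁ t)
    (hlt₂ : ∀ t ∈ Ioo a b, u₂ t < u t) (hle : u₂ b ≤ u b) : u b ≠ u₁ b := by
  intro heqb
  have hwronskian := lt_of_hasDerivAt_pos hab
    (u := fun t ↦ (u t - u₂ t) * (v₁ t - v t) - (v t - v₂ t) * (u₁ t - u t))
    (v := fun t ↦ 6 * (u₁ t - u₂ t) * (u t - u₂ t) * (u₁ t - u t))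
    (fun t ht ↦ ((((h.hasDerivAt t ht).sub (h₂.hasDerivAt t ht)).mul
        ((h₁.hasDerivAt_deriv t ht).sub (h.hasDerivAt_deriv t ht))).sub
      (((h.hasDerivAt_deriv t ht).sub (h₂.hasDerivAt_deriv t ht)).mul
        ((h₁.hasDerivAt t ht).sub (h.hasDerivAt t ht)))).congr_deriv
      (by simp only [Pi.sub_apply]; ring))
    (fun t ht ↦ by
      have hpos₁ := sub_pos.2 (hlt₁ t ht)
      have hpos₂ := sub_pos.2 (hlt₂ t ht)
      have hpos : 0 < u₁ t - u₂ t := by linarith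
      positivity)
  have hbI : b ∈ Icc a b := right_mem_Icc.2 hab.le
  have hv : v₁ b - v b ≤ 0 := deriv_nonpos_of_pos_left hab
    ((h₁.hasDerivAt b hbI).sub (h.hasDerivAt b hbI)) (sub_eq_zero.2 heqb.symm)
    fun t ht ↦ sub_pos.2 (hlt₁ t ht)
  simp only [heq₁, heq₂, heqb, sub_self, zero_mul, mul_zero] at hwronskian
  nlinarith [mul_nonneg_of_nonpos_of_nonpos hv (sub_nonpos.2 hle)]

end IsReflectedP1On

/-! ### The shooting problem -/

/-- The maximal solutions of `u'' = 6 u² + t + c`, `u(0) = y₀`, `u'(0) = m`, indexed by the initial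
slope `m`; `D m` is the interval of existence and `v m` is the derivative of `u m`. Maximality is
encoded by `closure_subset`: a solution cannot stop at a point near which its Cauchy data stay
bounded. -/
structure ShootingFamily (c y₀ : ℝ) where
  D : ℝ → Set ℝ
  u : ℝ → ℝ → ℝ
  v : ℝ → ℝ → ℝ
  c_nonneg : 0 ≤ c
  isOpen_D : ∀ m, IsOpen (D m)
  ordConnected_D : ∀ m, (D m).OrdConnected
  zero_mem : ∀ m, 0 ∈ D m
  u_zero : ∀ m, u m 0 = y₀
  v_zero : ∀ m, v m 0 = m
  solves : ∀ m, IsReflectedP1On c (u m) (v m) (D m)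
  closure_subset : ∀ m s K, s ⊆ D m → (∀ t ∈ s, |u m t| ≤ K ∧ |v m t| ≤ K) → closure s ⊆ D m

namespace ShootingFamily

variable {c y₀ : ℝ} (F : ShootingFamily c y₀) {m m₁ m₂ t T K : ℝ}

theorem Icc_subset (ht : t ∈ F.D m) : Icc 0 t ⊆ F.D m :=
  (F.ordConnected_D m).out (F.zero_mem m) ht

theorem solvesOn (ht : t ∈ F.D m) : IsReflectedP1On c (F.u m) (F.v m) (Icc 0 t) :=
  (F.solves m).mono (F.Icc_subset ht)

theorem u_zero_eq (m₁ m₂ : ℝ) : F.u m₁ 0 = F.u m₂ 0 := by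
  rw [F.u_zero, F.u_zero]

theorem v_zero_lt (h : m₂ < m₁) : F.v m₂ 0 < F.v m₁ 0 := by
  rwa [F.v_zero, F.v_zero]

theorem zero_add_nonneg (F : ShootingFamily c y₀) : 0 ≤ 0 + c := by
  simpa only [zero_add] using F.c_nonneg

theorem convexOn (ht : t ∈ F.D m) : ConvexOn ℝ (Icc 0 t) (F.u m) :=
  (F.solvesOn ht).convexOn F.zero_add_nonneg

theorem initial_tangent_le (ht : 0 ≤ t) (htD : t ∈ F.D m) : y₀ + m * t ≤ F.u m t := by
  rcases ht.eq_or_lt with rfl | ht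
  · simp [F.u_zero]
  have hslope := (F.convexOn htD).le_slope_of_hasDerivAt (left_mem_Icc.2 ht.le)
    (right_mem_Icc.2 ht.le) ht ((F.solves m).hasDerivAt 0 (F.zero_mem m))
  rw [slope_def_field, F.u_zero, F.v_zero, sub_zero, le_div_iff₀ ht] at hslope
  linarith

theorem le_deriv (ht : 0 ≤ t) (htD : t ∈ F.D m) : m ≤ F.v m t := by
  simpa only [F.v_zero] using (F.solvesOn htD).monotoneOn_deriv F.zero_add_nonneg
    (left_mem_Icc.2 ht) (right_mem_Icc.2 ht) ht

theorem deriv_le_of_abs_le (ht : 0 ≤ t) (htD : t ∈ F.D m) (hK : ∀ r ∈ Icc 0 t, |F.u m r| ≤ K) :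
    F.v m t ≤ m + (6 * K ^ 2 + t + c) * t := by
  simpa only [F.v_zero, sub_zero] using le_add_mul_sub ht (F.solvesOn htD).hasDerivAt_deriv
    fun r hr ↦ by linarith [sq_le_sq.2 ((hK r hr).trans (le_abs_self K)), hr.2]

theorem mem_of_abs_le (hT : 0 < T) (hD : Ico 0 T ⊆ F.D m) (hK : ∀ t ∈ Ico 0 T, |F.u m t| ≤ K) :
    T ∈ F.D m := by
  have hc := F.c_nonneg
  have hB : 0 ≤ 6 * K ^ 2 + T + c := by positivity
  have hcl : T ∈ closure (Ico 0 T) := by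
    rw [closure_Ico hT.ne]
    exact right_mem_Icc.2 hT.le
  refine F.closure_subset m _ (max K (|m| + (6 * K ^ 2 + T + c) * T)) hD (fun t ht ↦
    ⟨le_max_of_le_left (hK t ht), le_max_of_le_right (abs_le.2 ⟨?_, ?_⟩)⟩) hcl
  · have hlow := F.le_deriv ht.1 (hD ht)
    nlinarith [neg_abs_le m]
  · have hup := F.deriv_le_of_abs_le ht.1 (hD ht) fun r hr ↦ hK r ⟨hr.1, hr.2.trans_lt ht.2⟩
    have hmono : (6 * K ^ 2 + t + c) * t ≤ (6 * K ^ 2 + T + c) * T :=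
      mul_le_mul (by linarith [ht.2]) ht.2.le ht.1 hB
    linarith [le_abs_self m]

theorem abs_le_of_le (ht : t ∈ Icc 0 T) (htD : t ∈ F.D m) (hK : F.u m t ≤ K) :
    |F.u m t| ≤ |K| + |y₀| + |m| * T := by
  have htangent := F.initial_tangent_le ht.1 htD
  have hmt : |m * t| ≤ |m| * T := by
    rw [abs_mul, abs_of_nonneg ht.1]
    exact mul_le_mul_of_nonneg_left ht.2 (abs_nonneg m)
  refine abs_le.2 ⟨?_, ?_⟩
  · linarith [neg_abs_le y₀, (abs_le.1 hmt).1, abs_nonneg K]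
  · linarith [le_abs_self K, abs_nonneg y₀, (abs_nonneg _).trans hmt]

/-- By convexity a solution is bounded below, so only growth to `+∞` can stop it. -/
theorem mem_of_bddAbove (hT : 0 ≤ T) (hK : ∀ t ∈ Ico 0 T, t ∈ F.D m → F.u m t ≤ K) :
    T ∈ F.D m := by
  by_contra hTD
  have hcompact : IsCompact (Icc 0 T ∩ (F.D m)ᶜ) :=
    isCompact_Icc.inter_right (F.isOpen_D m).isClosed_compl
  obtain ⟨t₀, ⟨ht₀, ht₀D⟩, hleast⟩ := hcompact.exists_isLeast ⟨T, ⟨hT, le_rfl⟩, hTD⟩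
  have hpos : 0 < t₀ := ht₀.1.lt_of_ne fun h ↦ ht₀D (h ▸ F.zero_mem m)
  have hD : Ico 0 t₀ ⊆ F.D m := fun t ht ↦ by
    by_contra htD
    exact ht.2.not_ge (hleast ⟨⟨ht.1, ht.2.le.trans ht₀.2⟩, htD⟩)
  exact ht₀D (F.mem_of_abs_le hpos hD fun t ht ↦ F.abs_le_of_le ⟨ht.1, ht.2.le⟩ (hD ht)
    (hK t ⟨ht.1, ht.2.trans_le ht₀.2⟩ (hD ht)))

theorem exists_bound (hT : T ∈ F.D m) : ∃ K, ∀ t ∈ Icc 0 T, F.u m t ≤ K := by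
  obtain ⟨K, hK⟩ := isCompact_Icc.bddAbove_image (F.solvesOn hT).continuousOn
  exact ⟨K, forall_mem_image.1 hK⟩

/-! ### Meetings of solutions -/

theorem exists_first_meeting (hm : m₂ < m₁) (h₁ : T ∈ F.D m₁) (h₂ : T ∈ F.D m₂)
    (ht : t ∈ Ioc 0 T) (hle : F.u m₁ t ≤ F.u m₂ t) :
    ∃ p ∈ Ioc 0 t, F.u m₁ p = F.u m₂ p ∧ (∀ r ∈ Ioo 0 p, F.u m₂ r < F.u m₁ r) ∧
      ∀ r ∈ Ioc p T, F.u m₁ r < F.u m₂ r :=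
  (F.solvesOn h₁).exists_first_meeting F.zero_add_nonneg (F.solvesOn h₂) (F.u_zero_eq _ _)
    (F.v_zero_lt hm) ht hle

theorem lt_of_eq (hm : m₂ < m₁) (h₁ : T ∈ F.D m₁) (h₂ : T ∈ F.D m₂)
    (heq : F.u m₂ T = F.u m₁ T) : ∀ t ∈ Ioo 0 T, F.u m₂ t < F.u m₁ t :=
  (F.solvesOn h₁).lt_of_eq_of_eq F.zero_add_nonneg (F.solvesOn h₂) (F.u_zero_eq _ _)
    (F.v_zero_lt hm) heq

theorem ne_of_ordered (hT : 0 < T) (h₁ : T ∈ F.D m₁) (h : T ∈ F.D m) (h₂ : T ∈ F.D m₂)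
    (hlt₁ : ∀ t ∈ Ioo 0 T, F.u m t < F.u m₁ t) (hlt₂ : ∀ t ∈ Ioo 0 T, F.u m₂ t < F.u m t)
    (hle : F.u m₂ T ≤ F.u m T) : F.u m T ≠ F.u m₁ T :=
  IsReflectedP1On.ne_of_ordered hT (F.solvesOn h₁) (F.solvesOn h) (F.solvesOn h₂)
    (F.u_zero_eq _ _) (F.u_zero_eq _ _) hlt₁ hlt₂ hle

/-- While the middle solution stays above the lower one, it also stays below the upper one, since it
cannot meet the upper one first; then it reaches `T`, where the outer two meet. -/
theorem exists_le_of_between (hT : 0 < T) (hm₁ : m < m₁) (h₁ : T ∈ F.D m₁)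
    (h₂ : T ∈ F.D m₂) (heq : F.u m₂ T = F.u m₁ T) :
    ∃ t ∈ Ioc 0 T, t ∈ F.D m ∧ F.u m t ≤ F.u m₂ t := by
  by_contra! habove
  have hbelow : ∀ t ∈ Ioc 0 T, t ∈ F.D m → F.u m t < F.u m₁ t := by
    intro t ht htD
    by_contra! hle
    obtain ⟨p, hp, hmeet, hlt, -⟩ := F.exists_first_meeting hm₁ (F.Icc_subset h₁ ⟨ht.1.le, ht.2⟩)
      htD ⟨ht.1, le_rfl⟩ hle
    have hpT : p ∈ Ioc 0 T := ⟨hp.1, hp.2.trans ht.2⟩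
    have hD {r : ℝ} (hr : r ∈ Ioc 0 p) : r ∈ F.D m := F.Icc_subset htD ⟨hr.1.le, hr.2.trans hp.2⟩
    refine F.ne_of_ordered hp.1 (F.Icc_subset h₁ (Ioc_subset_Icc_self hpT)) (hD ⟨hp.1, le_rfl⟩)
      (F.Icc_subset h₂ (Ioc_subset_Icc_self hpT)) hlt
      (fun r hr ↦ habove r ⟨hr.1, hr.2.le.trans hpT.2⟩ (hD ⟨hr.1, hr.2.le⟩))
      (habove p hpT (hD ⟨hp.1, le_rfl⟩)).le hmeet.symm
  obtain ⟨K, hK⟩ := F.exists_bound h₁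
  have hTD : T ∈ F.D m := F.mem_of_bddAbove hT.le (K := K) fun t ht htD ↦ by
    rcases ht.1.eq_or_lt with rfl | ht0
    · exact (F.u_zero_eq m m₁).trans_le (hK 0 (left_mem_Icc.2 hT.le))
    · exact (hbelow t ⟨ht0, ht.2.le⟩ htD).le.trans (hK t (Ico_subset_Icc_self ht))
  exact (habove T ⟨hT, le_rfl⟩ hTD).not_gt (heq ▸ hbelow T ⟨hT, le_rfl⟩ hTD)

theorem lt_of_between (hT : 0 < T) (hm₂ : m₂ < m) (hm₁ : m < m₁) (h₁ : T ∈ F.D m₁)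
    (h₂ : T ∈ F.D m₂) (heq : F.u m₂ T = F.u m₁ T) : T ∈ F.D m ∧ F.u m T < F.u m₂ T := by
  obtain ⟨t₁, ht₁, ht₁D, hle⟩ := F.exists_le_of_between hT hm₁ h₁ h₂ heq
  have hafter : ∀ t ∈ Ioc t₁ T, t ∈ F.D m → F.u m t < F.u m₂ t := by
    intro t ht htD
    have ht0 : 0 < t := ht₁.1.trans ht.1
    obtain ⟨p, hp, -, -, hlt⟩ := F.exists_first_meeting hm₂ htD
      (F.Icc_subset h₂ ⟨ht0.le, ht.2⟩) ⟨ht₁.1, ht.1.le⟩ hle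
    exact hlt t ⟨hp.2.trans_lt ht.1, le_rfl⟩
  obtain ⟨K, hK⟩ := F.exists_bound ht₁D
  obtain ⟨K₂, hK₂⟩ := F.exists_bound h₂
  have hTD : T ∈ F.D m := F.mem_of_bddAbove hT.le (K := max K K₂) fun t ht htD ↦ by
    rcases le_or_gt t t₁ with htt₁ | htt₁
    · exact le_max_of_le_left (hK t ⟨ht.1, htt₁⟩)
    · exact le_max_of_le_right ((hafter t ⟨htt₁, ht.2.le⟩ htD).le.trans
        (hK₂ t (Ico_subset_Icc_self ht)))
  refine ⟨hTD, lt_of_le_of_ne ?_ fun heq₂ ↦ ?_⟩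
  · rcases ht₁.2.eq_or_lt with rfl | ht₁T
    · exact hle
    · exact (hafter T ⟨ht₁T, le_rfl⟩ hTD).le
  · exact F.ne_of_ordered hT h₁ hTD h₂ (F.lt_of_eq hm₁ h₁ hTD (heq₂.trans heq))
      (F.lt_of_eq hm₂ hTD h₂ heq₂.symm) heq₂.ge (heq₂.trans heq)

end ShootingFamily

/-! ### A priori bounds -/

/-- Reflect in the midpoint: the values at `t` and `a + b - t` average to at least `-C`. -/
theorem neg_three_mul_le_of_convexOn {f : ℝ → ℝ} {a b C t : ℝ} (hf : ConvexOn ℝ (Icc a b) f)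
    (ha : f a ≤ C) (hb : f b ≤ C) (hmid : -C ≤ f ((a + b) / 2)) (ht : t ∈ Icc a b) :
    -(3 * C) ≤ f t := by
  have ht' : a + b - t ∈ Icc a b := ⟨by linarith [ht.2], by linarith [ht.1]⟩
  have hab : a ≤ b := ht.1.trans ht.2
  have hmax : f (a + b - t) ≤ C := (hf.le_max_of_mem_Icc (left_mem_Icc.2 hab)
    (right_mem_Icc.2 hab) ht').trans (max_le ha hb)
  have haverage := hf.2 ht ht' one_half_pos.le one_half_pos.le (add_halves 1)
  simp only [smul_eq_mul] at haverage
  rw [show 1 / 2 * t + 1 / 2 * (a + b - t) = (a + b) / 2 by ring] at haverage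
  linarith

namespace ShootingFamily

variable {c y₀ : ℝ} (F : ShootingFamily c y₀) {m m₁ m₂ t T T₁ K b C ε : ℝ}

theorem u_le_max (ht : t ∈ Icc 0 T) (hT : T ∈ F.D m) : F.u m t ≤ max y₀ (F.u m T) := by
  have h0T : 0 ≤ T := ht.1.trans ht.2
  simpa only [F.u_zero] using
    (F.convexOn hT).le_max_of_mem_Icc (left_mem_Icc.2 h0T) (right_mem_Icc.2 h0T) ht

theorem le_of_initial_lt (ht : 0 ≤ t) (htT : t ≤ T) (hT : T ∈ F.D m) (hlt : y₀ < F.u m t) :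
    F.u m t ≤ F.u m T := by
  by_contra! hgt
  exact (F.u_le_max ⟨ht, htT⟩ hT).not_gt (max_lt hlt hgt)

theorem exists_lt_of_notMem (hT : 0 ≤ T) (hTD : T ∉ F.D m) (K : ℝ) :
    ∃ t ∈ Ico 0 T, t ∈ F.D m ∧ K < F.u m t := by
  by_contra! hK
  exact hTD (F.mem_of_bddAbove hT hK)

theorem abs_le_three_mul (hT : 0 < T) (hTD : T ∈ F.D m) (hC : 64 / T ^ 2 ≤ C) (hy₀ : y₀ ≤ C)
    (hu : F.u m T ≤ C) (ht : t ∈ Icc 0 T) : |F.u m t| ≤ 3 * C := by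
  have hC0 : 0 ≤ C := le_trans (by positivity) hC
  have hmid := neg_max_le_midpoint_of_six_mul_sq_le hT (F.solvesOn hTD).hasDerivAt
    (F.solvesOn hTD).hasDerivAt_deriv fun r hr ↦ by linarith [hr.1, F.c_nonneg]
  rw [sub_zero, F.u_zero] at hmid
  exact abs_le.2 ⟨neg_three_mul_le_of_convexOn (F.convexOn hTD) ((F.u_zero m).trans_le hy₀) hu
    ((neg_le_neg (max_le hC (max_le hy₀ hu))).trans hmid) ht,
    (F.u_le_max ht hTD).trans (max_le (by linarith) (by linarith))⟩

theorem le_initial_add (ht : t ∈ Icc 0 T) (htD : t ∈ F.D m)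
    (hK : ∀ r ∈ Icc 0 t, |F.u m r| ≤ K) :
    F.u m t ≤ y₀ + (m + (6 * K ^ 2 + T + c) * T) * t := by
  have hc := F.c_nonneg
  have hT : 0 ≤ T := ht.1.trans ht.2
  have hv : ∀ r ∈ Icc 0 t, F.v m r ≤ m + (6 * K ^ 2 + T + c) * T := fun r hr ↦ by
    have hrT : r ≤ T := hr.2.trans ht.2
    have hmono : (6 * K ^ 2 + r + c) * r ≤ (6 * K ^ 2 + T + c) * T :=
      mul_le_mul (by linarith) hrT hr.1 (by positivity)
    linarith [F.deriv_le_of_abs_le hr.1 (F.Icc_subset htD hr)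
      fun s hs ↦ hK s ⟨hs.1, hs.2.trans hr.2⟩]
  simpa only [F.u_zero, sub_zero] using le_add_mul_sub ht.1 (F.solvesOn htD).hasDerivAt hv

theorem abs_slope_le (hT : 0 < T) (hTD : T ∈ F.D m) (hK : ∀ t ∈ Icc 0 T, |F.u m t| ≤ K) :
    |m| ≤ 2 * K / T + (6 * K ^ 2 + T + c) * T := by
  have hc := F.c_nonneg
  have hTI : T ∈ Icc 0 T := right_mem_Icc.2 hT.le
  have hy₀ : |y₀| ≤ K := by simpa only [F.u_zero] using hK 0 (left_mem_Icc.2 hT.le)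
  obtain ⟨hy₀l, hy₀r⟩ := abs_le.1 hy₀
  obtain ⟨hul, hur⟩ := abs_le.1 (hK T hTI)
  have hlower : -(m + (6 * K ^ 2 + T + c) * T) ≤ 2 * K / T := by
    rw [le_div_iff₀ hT]
    linarith [F.le_initial_add hTI hTD hK]
  have hupper : m ≤ 2 * K / T := by
    rw [le_div_iff₀ hT]
    linarith [F.initial_tangent_le hT.le hTD]
  have hpos : 0 ≤ (6 * K ^ 2 + T + c) * T := by positivity
  exact abs_le.2 ⟨by linarith, by linarith⟩

theorem exists_slope_bound (hT₁ : 0 < T₁) (T₂ b : ℝ) :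
    ∃ N, ∀ T ∈ Icc T₁ T₂, ∀ m, T ∈ F.D m → F.u m T ≤ b → |m| ≤ N := by
  have hc := F.c_nonneg
  obtain ⟨K, hK⟩ : ∃ K, K = 3 * max (64 / T₁ ^ 2) (max y₀ b) := ⟨_, rfl⟩
  have hK0 : 0 ≤ K := by
    rw [hK]
    exact mul_nonneg zero_le_three (le_max_of_le_left (by positivity))
  refine ⟨2 * K / T₁ + (6 * K ^ 2 + T₂ + c) * T₂, fun T hT m hTD hb ↦ ?_⟩
  have hT0 : 0 < T := hT₁.trans_le hT.1
  have h64 : 64 / T ^ 2 ≤ 64 / T₁ ^ 2 := by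
    gcongr
    exact hT.1
  have hslope := F.abs_slope_le hT0 hTD (K := K) fun t ht ↦ hK ▸ F.abs_le_three_mul hT0 hTD
    (le_max_of_le_left h64) (le_max_of_le_right (le_max_left _ _))
    (hb.trans (le_max_of_le_right (le_max_right _ _))) ht
  refine hslope.trans (add_le_add ?_ (mul_le_mul ?_ hT.2 hT0.le ?_))
  · exact div_le_div_of_nonneg_left (by positivity) hT₁ hT.1
  · linarith [hT.2]
  · have : 0 ≤ T₂ := hT0.le.trans hT.2
    positivity

/-- The forcing term `t` makes a solution on a long interval overshoot any given level. -/
theorem exists_time_bound (b : ℝ) :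
    ∃ T₂, ∀ T m, T ∈ F.D m → F.u m T ≤ b → T ≤ T₂ := by
  obtain ⟨C, hC⟩ : ∃ C, C = max 1 (max y₀ b) := ⟨_, rfl⟩
  have hC1 : 1 ≤ C := hC ▸ le_max_left _ _
  refine ⟨8 + 4 * C, fun T m hTD hb ↦ ?_⟩
  by_contra! hT
  have hT0 : 0 < T := by linarith
  have hTC : F.u m T ≤ C := hC ▸ hb.trans (le_max_of_le_right (le_max_right _ _))
  have h64 : 64 / T ^ 2 ≤ C := by
    refine le_trans ?_ hC1
    rw [div_le_one (by positivity)]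
    nlinarith
  have hy₀ : y₀ ≤ C := hC ▸ le_max_of_le_right (le_max_left _ _)
  have hbound : ∀ t ∈ Icc 0 T, |F.u m t| ≤ 3 * C :=
    fun t ht ↦ F.abs_le_three_mul hT0 hTD h64 hy₀ hTC ht
  have hsub : Icc (T / 2) T ⊆ Icc 0 T := Icc_subset_Icc_left (by linarith)
  have hhalf := (F.solvesOn hTD).mono hsub
  have hmid := midpoint_add_sq_le_of_le_deriv2 (k := T / 2) (by linarith) hhalf.hasDerivAt
    hhalf.hasDerivAt_deriv fun r hr ↦ by linarith [hr.1, F.c_nonneg, sq_nonneg (F.u m r)]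
  have hupper := (abs_le.1 (hbound (T / 2) ⟨by linarith, by linarith⟩)).2
  have hlower := (abs_le.1 (hbound ((T / 2 + T) / 2) ⟨by linarith, by linarith⟩)).1
  have hcubic : T * T ^ 2 ≤ 64 * (5 * C) := by linarith
  nlinarith [hcubic]

/-! ### Steep solutions -/

/-- The first return to the height `y₀` would contradict the bound on `u''`. -/
theorem le_initial_of_steep (hm : m + (6 * K ^ 2 + T + c) * T < 0) (hy₀ : y₀ ≤ K)
    (hK : ∀ t ∈ Icc 0 T, t ∈ F.D m → -K ≤ F.u m t) (ht : t ∈ Icc 0 T) (htD : t ∈ F.D m) :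
    F.u m t ≤ y₀ := by
  have hc := F.c_nonneg
  have hT : 0 ≤ T := ht.1.trans ht.2
  have hm0 : m < 0 := by linarith [(by positivity : 0 ≤ (6 * K ^ 2 + T + c) * T)]
  by_contra! hgt
  have ht0 : 0 < t := ht.1.lt_of_ne fun h ↦ hgt.ne (h ▸ F.u_zero m).symm
  obtain ⟨p, hp, hzero, hpos⟩ := exists_first_zero ht0
    (continuousOn_const.sub (F.solvesOn htD).continuousOn)
    (eventually_nhdsGT_pos_of_deriv_pos (((F.solves m).hasDerivAt 0 (F.zero_mem m)).const_sub y₀)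
      (sub_eq_zero.2 (F.u_zero m).symm) (by rwa [F.v_zero, neg_pos])) (sub_nonpos.2 hgt.le)
  have hle : ∀ r ∈ Icc 0 p, F.u m r ≤ y₀ := fun r hr ↦ sub_nonneg.1
    (nonneg_Icc_of_pos_Ioo (u := fun r ↦ y₀ - F.u m r) (sub_nonneg.2 (F.u_zero m).le) hzero.ge
      hpos r hr)
  have hpD : ∀ r ∈ Icc 0 p, r ∈ F.D m := fun r hr ↦ F.Icc_subset htD ⟨hr.1, hr.2.trans hp.2⟩
  have hreturn := F.le_initial_add (T := T) (K := K) ⟨hp.1.le, hp.2.trans ht.2⟩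
    (hpD p (right_mem_Icc.2 hp.1.le)) fun r hr ↦ abs_le.2
      ⟨hK r ⟨hr.1, hr.2.trans (hp.2.trans ht.2)⟩ (hpD r hr), (hle r hr).trans hy₀⟩
  linarith [mul_neg_of_neg_of_pos hm hp.1, sub_eq_zero.1 hzero]

theorem exists_lt (hT : 0 < T) (b : ℝ) : ∃ m, ∃ t ∈ Icc 0 T, t ∈ F.D m ∧ F.u m t < b := by
  obtain ⟨K, hKy₀, hKb⟩ : ∃ K, |y₀| ≤ K ∧ |b| ≤ K :=
    ⟨max |y₀| |b|, le_max_left _ _, le_max_right _ _⟩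
  have hK0 : 0 ≤ K := (abs_nonneg _).trans hKy₀
  obtain ⟨m, hm⟩ : ∃ m, m + (6 * K ^ 2 + T + c) * T = -((2 * K + 1) / T) :=
    ⟨-((2 * K + 1) / T) - (6 * K ^ 2 + T + c) * T, sub_add_cancel _ _⟩
  refine ⟨m, ?_⟩
  by_contra! hge
  have hK : ∀ t ∈ Icc 0 T, t ∈ F.D m → -K ≤ F.u m t := fun t ht htD ↦
    (neg_le_of_abs_le hKb).trans (hge t ht htD)
  have hneg : m + (6 * K ^ 2 + T + c) * T < 0 := by
    rw [hm, neg_lt_zero]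
    positivity
  have hle : ∀ t ∈ Icc 0 T, t ∈ F.D m → F.u m t ≤ y₀ := fun t ht htD ↦
    F.le_initial_of_steep hneg ((le_abs_self _).trans hKy₀) hK ht htD
  have hTD : T ∈ F.D m := F.mem_of_bddAbove hT.le fun t ht htD ↦ hle t (Ico_subset_Icc_self ht) htD
  have hTI : T ∈ Icc 0 T := right_mem_Icc.2 hT.le
  have hu := F.le_initial_add (K := K) hTI hTD fun t ht ↦ by
    have htD := F.Icc_subset hTD ht
    exact abs_le.2 ⟨hK t ht htD, (hle t ht htD).trans ((le_abs_self _).trans hKy₀)⟩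
  rw [hm, neg_mul, div_mul_cancel₀ _ hT.ne'] at hu
  linarith [hK T hTI hTD, le_abs_self y₀]

/-- Otherwise the solution would be bounded above, hence global, against `exists_time_bound`. -/
theorem exists_eq_of_lt (ht : 0 ≤ t) (htD : t ∈ F.D m) (hlt : F.u m t < b) :
    ∃ T > t, T ∈ F.D m ∧ F.u m T = b := by
  by_contra! hne
  have hbelow : ∀ r ≥ t, r ∈ F.D m → F.u m r < b := by
    intro r hr hrD
    by_contra! hle
    have hsub : Icc t r ⊆ Icc 0 r := Icc_subset_Icc_left ht
    obtain ⟨p, hp, hpb⟩ := intermediate_value_Icc hr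
      ((F.solvesOn hrD).continuousOn.mono hsub) ⟨hlt.le, hle⟩
    have htp : t < p := hp.1.lt_of_ne fun h ↦ hlt.ne (h ▸ hpb)
    exact hne p htp (F.Icc_subset hrD (hsub hp)) hpb
  have hglobal : ∀ T ≥ 0, T ∈ F.D m := fun T hT ↦ by
    refine F.mem_of_bddAbove hT (K := max y₀ b) fun r hr hrD ↦ ?_
    rcases le_total r t with hrt | hrt
    · exact (F.u_le_max ⟨hr.1, hrt⟩ htD).trans (max_le_max le_rfl hlt.le)
    · exact le_max_of_le_right (hbelow r hrt hrD).le
  obtain ⟨T₂, hT₂⟩ := F.exists_time_bound b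
  have hD := hglobal (max t (T₂ + 1)) (ht.trans (le_max_left _ _))
  linarith [hT₂ _ m hD (hbelow _ (le_max_left _ _) hD).le, le_max_right t (T₂ + 1)]

/-! ### Dependence on the slope -/

theorem abs_sub_le_mul_exp (ht : t ∈ Icc 0 T) (h₁ : t ∈ F.D m₁) (h₂ : t ∈ F.D m₂)
    (hK : ∀ r ∈ Icc 0 t, |F.u m₁ r| ≤ K) (hclose : ∀ r ∈ Icc 0 t, |F.u m₂ r - F.u m₁ r| ≤ 1) :
    |F.u m₂ t - F.u m₁ t| ≤ |m₂ - m₁| * Real.exp ((1 + 12 * (K + 1)) * T) := by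
  have hK0 : 0 ≤ K := (abs_nonneg _).trans (hK 0 (left_mem_Icc.2 ht.1))
  have hq : ∀ r ∈ Icc 0 t, |6 * (F.u m₂ r + F.u m₁ r)| ≤ 12 * (K + 1) := fun r hr ↦ by
    have h₁ := abs_le.1 (hK r hr)
    have h₂ := abs_le.1 (hclose r hr)
    exact abs_le.2 ⟨by linarith [h₁.1, h₂.1], by linarith [h₁.2, h₂.2]⟩
  have hgronwall := norm_cauchyData_le_mul_exp (d := fun r ↦ F.u m₂ r - F.u m₁ r)
    (δ := fun r ↦ F.v m₂ r - F.v m₁ r) ht.1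
    (fun r hr ↦ ((F.solvesOn h₂).hasDerivAt r hr).sub ((F.solvesOn h₁).hasDerivAt r hr))
    (fun r hr ↦ (((F.solvesOn h₂).hasDerivAt_deriv r hr).sub
      ((F.solvesOn h₁).hasDerivAt_deriv r hr)).congr_deriv (by ring)) hq
  simp only [F.u_zero, F.v_zero, sub_self, sub_zero, Prod.norm_mk, norm_zero, Real.norm_eq_abs,
    max_eq_right (abs_nonneg (m₂ - m₁))] at hgronwall
  refine (le_max_left _ _).trans (hgronwall.trans ?_)
  gcongr
  exact ht.2

theorem abs_sub_lt_of_small (hT : T ∈ F.D m₁) (hK : ∀ t ∈ Icc 0 T, |F.u m₁ t| ≤ K) (hε : ε ≤ 1)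
    (hsmall : |m₂ - m₁| * Real.exp ((1 + 12 * (K + 1)) * T) < ε) (ht : t ∈ Icc 0 T)
    (h₂ : t ∈ F.D m₂) : |F.u m₂ t - F.u m₁ t| < ε := by
  have h₁ : t ∈ F.D m₁ := F.Icc_subset hT ht
  have hε0 : 0 < ε := lt_of_le_of_lt (by positivity) hsmall
  have hinit : |F.u m₂ 0 - F.u m₁ 0| < ε := by
    rwa [F.u_zero_eq m₂ m₁, sub_self, abs_zero]
  by_contra! hge
  have ht0 : 0 < t := ht.1.lt_of_ne fun h ↦ hge.not_gt (h ▸ hinit)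
  have hcont : ContinuousAt (fun r ↦ ε - |F.u m₂ r - F.u m₁ r|) 0 :=
    continuousAt_const.sub (((F.solves m₂).hasDerivAt 0 (F.zero_mem m₂)).continuousAt.sub
      ((F.solves m₁).hasDerivAt 0 (F.zero_mem m₁)).continuousAt).abs
  obtain ⟨p, hp, hzero, hpos⟩ := exists_first_zero ht0
    (continuousOn_const.sub ((F.solvesOn h₂).continuousOn.sub (F.solvesOn h₁).continuousOn).abs)
    ((hcont.eventually (lt_mem_nhds (sub_pos.2 hinit))).filter_mono nhdsWithin_le_nhds)
    (sub_nonpos.2 hge)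
  have hclose : ∀ r ∈ Icc 0 p, |F.u m₂ r - F.u m₁ r| ≤ ε := fun r hr ↦ sub_nonneg.1
    (nonneg_Icc_of_pos_Ioo (u := fun r ↦ ε - |F.u m₂ r - F.u m₁ r|) (sub_nonneg.2 hinit.le)
      hzero.ge hpos r hr)
  have hpt : p ∈ Icc 0 t := ⟨hp.1.le, hp.2⟩
  have hbound := F.abs_sub_le_mul_exp (T := T) ⟨hp.1.le, hp.2.trans ht.2⟩ (F.Icc_subset h₁ hpt)
    (F.Icc_subset h₂ hpt) (fun r hr ↦ hK r ⟨hr.1, hr.2.trans (hp.2.trans ht.2)⟩)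
    (fun r hr ↦ (hclose r hr).trans hε)
  exact ((sub_eq_zero.1 hzero).trans_le hbound).not_gt hsmall

theorem eventually_abs_sub_lt (hT : 0 ≤ T) (hTD : T ∈ F.D m) (hε : 0 < ε) :
    ∀ᶠ m' in 𝓝 m, T ∈ F.D m' ∧ ∀ t ∈ Icc 0 T, |F.u m' t - F.u m t| < ε := by
  obtain ⟨K, hK⟩ := isCompact_Icc.exists_bound_of_continuousOn (F.solvesOn hTD).continuousOn
  have hcont : Continuous fun m' ↦ |m' - m| * Real.exp ((1 + 12 * (K + 1)) * T) := by fun_prop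
  have hsmall : ∀ᶠ m' in 𝓝 m, |m' - m| * Real.exp ((1 + 12 * (K + 1)) * T) < min ε 1 :=
    hcont.continuousAt.eventually (gt_mem_nhds (by simpa using hε))
  filter_upwards [hsmall] with m' hm'
  have hclose : ∀ t ∈ Icc 0 T, t ∈ F.D m' → |F.u m' t - F.u m t| < min ε 1 := fun t ht htD ↦
    F.abs_sub_lt_of_small hTD hK (min_le_right _ _) hm' ht htD
  have hTD' : T ∈ F.D m' := F.mem_of_bddAbove hT (K := K + 1) fun t ht htD ↦ by
    have htI := Ico_subset_Icc_self ht
    linarith [(abs_lt.1 ((hclose t htI htD).trans_le (min_le_right _ _))).2,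
      (abs_le.1 (hK t htI)).2]
  exact ⟨hTD', fun t ht ↦ (hclose t ht (F.Icc_subset hTD' ht)).trans_le (min_le_left _ _)⟩

theorem tendsto_uncurry_u (ht : 0 ≤ t) (htD : t ∈ F.D m) :
    Tendsto (Function.uncurry F.u) (𝓝[{z | 0 ≤ z.2}] (m, t)) (𝓝 (F.u m t)) := by
  rw [Metric.tendsto_nhds]
  intro ε hε
  have hnear : ∀ᶠ r in 𝓝 t, r ∈ F.D m ∧ dist (F.u m r) (F.u m t) < ε / 2 :=
    ((F.isOpen_D m).eventually_mem htD).and (Metric.tendsto_nhds.1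
      ((F.solves m).hasDerivAt t htD).continuousAt (ε / 2) (half_pos hε))
  obtain ⟨T, hTD, hT⟩ := ((((F.isOpen_D m).eventually_mem htD).filter_mono
    nhdsWithin_le_nhds).and (self_mem_nhdsWithin (s := Ioi t))).exists
  have hT0 : 0 ≤ T := ht.trans (le_of_lt hT)
  have hprod := (F.eventually_abs_sub_lt hT0 hTD (half_pos hε)).prod_nhds
    (hnear.and (gt_mem_nhds hT))
  filter_upwards [nhdsWithin_le_nhds hprod, self_mem_nhdsWithin] with ⟨m', r⟩ hz hr
  obtain ⟨⟨-, hslope⟩, ⟨-, htime⟩, hrT⟩ := hz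
  calc dist (F.u m' r) (F.u m t) ≤ dist (F.u m' r) (F.u m r) + dist (F.u m r) (F.u m t) :=
        dist_triangle _ _ _
    _ < ε / 2 + ε / 2 := add_lt_add (hslope r ⟨hr, hrT.le⟩) htime
    _ = ε := add_halves ε

theorem eventually_and_lt (hT : 0 ≤ T) (hTD : T ∈ F.D m) (hb : F.u m T < b) :
    ∀ᶠ m' in 𝓝 m, T ∈ F.D m' ∧ F.u m' T < b := by
  filter_upwards [F.eventually_abs_sub_lt hT hTD (sub_pos.2 hb)] with m' hm'
  exact ⟨hm'.1, by linarith [(abs_lt.1 (hm'.2 T (right_mem_Icc.2 hT))).2]⟩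

theorem isOpen_setOf_lt (hT : 0 ≤ T) (b : ℝ) : IsOpen {m | T ∈ F.D m ∧ F.u m T < b} :=
  isOpen_iff_mem_nhds.2 fun _ hm ↦ F.eventually_and_lt hT hm.1 hm.2

/-- A blown-up solution counts as lying above `w`. -/
theorem eventually_lt {w : ℝ → ℝ} (ht : 0 ≤ t) (hw : ContinuousAt w t)
    (hlt : t ∈ F.D m → w t < F.u m t) :
    ∀ᶠ z : ℝ × ℝ in 𝓝 (m, t), 0 ≤ z.2 → z.2 ∈ F.D z.1 → w z.2 < F.u z.1 z.2 := by
  have hwz : Tendsto (fun z : ℝ × ℝ ↦ w z.2) (𝓝 (m, t)) (𝓝 (w t)) :=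
    hw.tendsto.comp continuousAt_snd
  by_cases htD : t ∈ F.D m
  · have hev := (hwz.mono_left nhdsWithin_le_nhds).eventually_lt (F.tendsto_uncurry_u ht htD)
      (hlt htD)
    filter_upwards [eventually_nhdsWithin_iff.1 hev] with z hz h0 _
    exact hz h0
  · obtain ⟨p, hp, hpD, hgt⟩ := F.exists_lt_of_notMem ht htD (max y₀ (w t))
    obtain ⟨b, hb, hbu⟩ := exists_between hgt
    obtain ⟨hy₀b, hwb⟩ := max_lt_iff.1 hb
    have hslope : ∀ᶠ m' in 𝓝 m, b < F.u m' p := by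
      filter_upwards [F.eventually_abs_sub_lt hp.1 hpD (sub_pos.2 hbu)] with m' hm'
      linarith [(abs_lt.1 (hm'.2 p (right_mem_Icc.2 hp.1))).1]
    filter_upwards [hwz.eventually_lt_const hwb, hslope.prod_nhds (lt_mem_nhds hp.2)]
      with z hwz hz _ hzD
    exact (hwz.trans hz.1).trans_le
      (F.le_of_initial_lt hp.1 hz.2.le hzD (hy₀b.trans hz.1))

theorem isOpen_setOf_forall_lt {w : ℝ → ℝ} {s : Set ℝ} (hs : IsCompact s) (hs0 : ∀ t ∈ s, 0 ≤ t)
    (hw : ∀ t ∈ s, ContinuousAt w t) : IsOpen {m | ∀ t ∈ s, t ∈ F.D m → w t < F.u m t} := by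
  refine isOpen_iff_mem_nhds.2 fun m hm ↦ ?_
  have hev := hs.eventually_forall_of_forall_eventually
    (P := fun m' t ↦ 0 ≤ t → t ∈ F.D m' → w t < F.u m' t) fun t ht ↦
      F.eventually_lt (hs0 t ht) (hw t ht) (hm t ht)
  filter_upwards [hev] with m' hm' t ht
  exact hm' t ht (hs0 t ht)

theorem isClosed_setOf_le (b : ℝ) :
    IsClosed {z : ℝ × ℝ | 0 ≤ z.2 ∧ z.2 ∈ F.D z.1 ∧ F.u z.1 z.2 ≤ b} := by
  refine isOpen_compl_iff.1 (isOpen_iff_mem_nhds.2 fun ⟨m, t⟩ hz ↦ ?_)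
  rcases lt_or_ge t 0 with ht | ht
  · filter_upwards [continuousAt_snd.eventually (gt_mem_nhds ht)] with z hz0 hz
    exact hz0.not_ge hz.1
  · have hlt : t ∈ F.D m → b < F.u m t := fun htD ↦ lt_of_not_ge fun hle ↦ hz ⟨ht, htD, hle⟩
    filter_upwards [F.eventually_lt ht continuousAt_const hlt] with z hz hle
    exact (hz hle.1 hle.2.1).not_ge hle.2.2

end ShootingFamily

/-! ### Comparison with strict subsolutions -/

theorem deriv2_nonneg_of_isLocalMin {u v : ℝ → ℝ} {a r : ℝ} (hmin : IsLocalMin u a)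
    (hu : ∀ᶠ t in 𝓝 a, HasDerivAt u (v t) t) (hv : HasDerivAt v r a) : 0 ≤ r := by
  by_contra! hr
  have hva : v a = 0 := hmin.hasDerivAt_eq_zero hu.self_of_nhds
  have hneg : ∀ᶠ t in 𝓝[>] a, 0 < -v t :=
    eventually_nhdsGT_pos_of_deriv_pos hv.neg (neg_eq_zero.2 hva) (neg_pos.2 hr)
  obtain ⟨p, hp, hIoc⟩ := mem_nhdsGT_iff_exists_Ioc_subset.1
    (hneg.and ((hu.and hmin).filter_mono nhdsWithin_le_nhds))
  have hderiv : ∀ t ∈ Icc a p, HasDerivAt u (v t) t := fun t ht ↦ by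
    rcases ht.1.eq_or_lt with rfl | hat
    · exact hu.self_of_nhds
    · exact (hIoc ⟨hat, ht.2⟩).2.1
  have hlt : -u a < -u p := lt_of_hasDerivAt_pos (u := fun t ↦ -u t) hp
    (fun t ht ↦ (hderiv t ht).neg) fun t ht ↦ (hIoc (Ioo_subset_Ioc_self ht)).1
  exact (neg_lt_neg_iff.1 hlt).not_ge (hIoc (right_mem_Ioc.2 hp)).2.2

theorem exists_pos_six_mul_sub_sq_lt {τ : ℝ} (hτ : 0 < τ) (K : ℝ) :
    ∃ ε > 0, ∀ x, |x| ≤ K → 6 * (x - ε) ^ 2 < 6 * x ^ 2 + τ := by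
  rcases lt_or_ge K 0 with hK | _
  · exact ⟨1, one_pos, fun x hx ↦ absurd (hx.trans_lt hK) (abs_nonneg x).not_gt⟩
  have hlim : Tendsto (fun ε : ℝ ↦ 12 * K * ε + 6 * ε ^ 2) (𝓝 0) (𝓝 0) :=
    Continuous.tendsto' (by fun_prop) _ _ (by norm_num)
  obtain ⟨ε, hε, hε0⟩ := (((hlim.eventually_lt_const hτ).filter_mono nhdsWithin_le_nhds).and
    (self_mem_nhdsWithin (s := Ioi (0 : ℝ)))).exists
  refine ⟨ε, hε0, fun x hx ↦ ?_⟩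
  nlinarith [mul_le_mul_of_nonneg_right (neg_le_of_abs_le hx) hε0.le]

namespace ShootingFamily

variable {c y₀ : ℝ} (F : ShootingFamily c y₀) {m m₁ T T' b : ℝ}

section Subsolution

variable {w w' w'' : ℝ → ℝ} (hw : ∀ t ∈ Icc 0 T, HasDerivAt w (w' t) t)
  (hw' : ∀ t ∈ Icc 0 T, HasDerivAt w' (w'' t) t)
  (hsub : ∀ t ∈ Icc 0 T, 6 * w t ^ 2 + t + c < w'' t)

include hw hw' hsub

theorem lt_of_le_of_subsolution (hle : ∀ t ∈ Icc 0 T, t ∈ F.D m → w t ≤ F.u m t) (h0 : w 0 < y₀)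
    (hT : T ∈ F.D m → w T < F.u m T) {t : ℝ} (ht : t ∈ Icc 0 T) (htD : t ∈ F.D m) :
    w t < F.u m t := by
  refine (hle t ht htD).lt_of_ne fun htouch ↦ ?_
  have ht0 : 0 < t := ht.1.lt_of_ne fun h ↦ h0.ne (by rw [← F.u_zero m, h, htouch])
  have htT : t < T := ht.2.lt_of_ne fun h ↦ (hT (h ▸ htD)).ne (h ▸ htouch)
  have hnear : ∀ᶠ s in 𝓝 t, s ∈ Icc 0 T ∧ s ∈ F.D m :=
    (eventually_mem_set.2 (Icc_mem_nhds ht0 htT)).and ((F.isOpen_D m).eventually_mem htD)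
  have hmin : IsLocalMin (fun s ↦ F.u m s - w s) t := by
    filter_upwards [hnear] with s hs
    rw [htouch, sub_self]
    exact sub_nonneg.2 (hle s hs.1 hs.2)
  have hderiv2 := deriv2_nonneg_of_isLocalMin hmin
    (hnear.mono fun s hs ↦ ((F.solves m).hasDerivAt s hs.2).sub (hw s hs.1))
    (((F.solves m).hasDerivAt_deriv t htD).sub (hw' t ht))
  have hstrict := hsub t ht
  rw [htouch] at hstrict
  exact hderiv2.not_gt (sub_neg.2 hstrict)

/-- Otherwise no solution could touch `w` from above, and the slopes would split into the open sets
of solutions staying above `w` and of solutions going below it. -/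
theorem exists_le_of_subsolution (hT : 0 < T) (hwy₀ : ∀ t ∈ Icc 0 T, w t < y₀) :
    ∃ m, T ∈ F.D m ∧ F.u m T ≤ w T := by
  by_contra! habove
  have hopen₁ : IsOpen {m | ∀ t ∈ Icc 0 T, t ∈ F.D m → w t < F.u m t} :=
    F.isOpen_setOf_forall_lt isCompact_Icc (fun t ht ↦ ht.1) fun t ht ↦ (hw t ht).continuousAt
  have hopen₂ : IsOpen (⋃ t ∈ Icc 0 T, {m | t ∈ F.D m ∧ F.u m t < w t}) :=
    isOpen_biUnion fun t ht ↦ F.isOpen_setOf_lt ht.1 (w t)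
  have hflat : ∀ t ∈ Icc 0 T, t ∈ F.D 0 → w t < F.u 0 t := fun t ht htD ↦
    (hwy₀ t ht).trans_le (by simpa using F.initial_tangent_le ht.1 htD)
  obtain ⟨B, hB⟩ := isCompact_Icc.bddBelow_image fun t ht ↦
    (hw t ht).continuousAt.continuousWithinAt
  obtain ⟨m, t, ht, htD, hlt⟩ := F.exists_lt hT B
  obtain ⟨k, -, hk₁, hk₂⟩ := isPreconnected_univ _ _ hopen₁ hopen₂
    (fun m _ ↦ or_iff_not_imp_right.2 fun hm t ht htD ↦
      F.lt_of_le_of_subsolution hw hw' hsub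
        (fun s hs hsD ↦ le_of_not_gt fun h ↦ hm (mem_biUnion hs ⟨hsD, h⟩))
        (hwy₀ 0 (left_mem_Icc.2 hT.le)) (habove m) ht htD)
    ⟨0, mem_univ _, hflat⟩
    ⟨m, mem_univ _, mem_biUnion ht ⟨htD, hlt.trans_le (hB (mem_image_of_mem w ht))⟩⟩
  obtain ⟨s, hs, hsD, hslt⟩ := mem_iUnion₂.1 hk₂
  exact (hk₁ s hs hsD).not_gt hslt

end Subsolution

/-- For `y₀ < b` the convex `u` is already below `b` at time `T`. For `b ≤ y₀` the earlier start
`u (· + τ) - ε` is a strict subsolution. -/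
theorem exists_undershoot (hT : 0 < T) (hTT' : T < T') (hD : T' ∈ F.D m) (hb : F.u m T' = b) :
    ∃ m', T ∈ F.D m' ∧ F.u m' T < b := by
  rcases lt_or_ge y₀ b with hlt | hle
  · have hTI : T ∈ Icc 0 T' := ⟨hT.le, hTT'.le⟩
    refine ⟨m, F.Icc_subset hD hTI, ?_⟩
    by_contra! hge
    have hrise := (F.convexOn hD).lt_right_of_left_lt (left_mem_Icc.2 (hT.trans hTT').le)
      (right_mem_Icc.2 (hT.trans hTT').le)
      (openSegment_eq_Ioo (hT.trans hTT') ▸ mem_Ioo.2 ⟨hT, hTT'⟩)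
      (by rw [F.u_zero]; exact hlt.trans_le hge)
    exact (hge.trans_lt hrise).ne' hb
  obtain ⟨τ, rfl⟩ : ∃ τ, T' = T + τ := ⟨T' - T, by ring⟩
  have hτ : 0 < τ := by linarith
  have hshift : ∀ t ∈ Icc 0 T, t + τ ∈ Icc 0 (T + τ) :=
    fun t ht ↦ ⟨by linarith [ht.1], by linarith [ht.2]⟩
  obtain ⟨K, hK⟩ := isCompact_Icc.exists_bound_of_continuousOn (F.solvesOn hD).continuousOn
  obtain ⟨ε, hε, hsq⟩ := exists_pos_six_mul_sub_sq_lt hτ K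
  obtain ⟨m', hTD, hu⟩ := F.exists_le_of_subsolution (w := fun t ↦ F.u m (t + τ) - ε)
    (fun t ht ↦ (((F.solvesOn hD).hasDerivAt _ (hshift t ht)).comp_add_const t τ).sub_const ε)
    (fun t ht ↦ ((F.solvesOn hD).hasDerivAt_deriv _ (hshift t ht)).comp_add_const t τ)
    (fun t ht ↦ by linarith [hsq _ (hK _ (hshift t ht))]) hT
    fun t ht ↦ by linarith [F.u_le_max (hshift t ht) hD, hb ▸ max_eq_left hle]
  exact ⟨m', hTD, hu.trans_lt (by linarith)⟩

/-! ### Counting the solutions that reach a given level at a given time -/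

/-- The slopes `m` whose solution `u m` takes the value `b` at time `T`, that is, the solutions of
the boundary value problem `u 0 = y₀`, `u T = b`. -/
def hittingSlopes (T b : ℝ) : Set ℝ :=
  {m | T ∈ F.D m ∧ F.u m T = b}

theorem inter_hittingSlopes_nonempty {S : Set ℝ} (hS : IsPreconnected S) (hT : 0 ≤ T) (hm : m ∈ S)
    (hTD : T ∈ F.D m) (hlt : F.u m T < b) (hm₁ : m₁ ∈ S) (hgt : T ∈ F.D m₁ → b < F.u m₁ T) :
    (S ∩ F.hittingSlopes T b).Nonempty := by
  by_contra hempty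
  have hopen : IsOpen {m | ∀ t ∈ ({T} : Set ℝ), t ∈ F.D m → b < F.u m t} :=
    F.isOpen_setOf_forall_lt isCompact_singleton (by simpa using hT) fun _ _ ↦ continuousAt_const
  obtain ⟨k, -, ⟨hkD, hklt⟩, hkgt⟩ := hS _ _ (F.isOpen_setOf_lt hT b) hopen
    (fun k hk ↦ or_iff_not_imp_left.2 fun hge t ht htD ↦ by
      rw [mem_singleton_iff.1 ht] at htD ⊢
      exact (le_of_not_gt fun h ↦ hge ⟨htD, h⟩).lt_of_ne' fun h ↦ hempty ⟨k, hk, htD, h⟩)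
    ⟨m, hm, hTD, hlt⟩ ⟨m₁, hm₁, by simpa using hgt⟩
  exact hklt.not_gt (hkgt T rfl hkD)

theorem lt_of_between_hittingSlopes {m₂ : ℝ} (hT : 0 < T) (h₂ : m₂ ∈ F.hittingSlopes T b)
    (h₁ : m₁ ∈ F.hittingSlopes T b) (hm₂ : m₂ < m) (hm₁ : m < m₁) :
    T ∈ F.D m ∧ F.u m T < b := by
  obtain ⟨hTD, hlt⟩ := F.lt_of_between hT hm₂ hm₁ h₁.1 h₂.1 (h₂.2.trans h₁.2.symm)
  exact ⟨hTD, h₂.2 ▸ hlt⟩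

theorem hittingSlopes_subsingleton (hT : 0 < T) (hge : ∀ m, T ∈ F.D m → b ≤ F.u m T) :
    (F.hittingSlopes T b).Subsingleton := by
  have hle : ∀ m₁ ∈ F.hittingSlopes T b, ∀ m₂ ∈ F.hittingSlopes T b, m₁ ≤ m₂ := by
    intro m₁ h₁ m₂ h₂
    by_contra! hlt
    obtain ⟨m, hm₂, hm₁⟩ := exists_between hlt
    obtain ⟨hTD, hu⟩ := F.lt_of_between_hittingSlopes hT h₂ h₁ hm₂ hm₁
    exact (hge m hTD).not_gt hu
  exact fun m₁ h₁ m₂ h₂ ↦ (hle m₁ h₁ m₂ h₂).antisymm (hle m₂ h₂ m₁ h₁)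

theorem encard_hittingSlopes_eq_two (hT : 0 < T) (hTD : T ∈ F.D m) (hlt : F.u m T < b) :
    (F.hittingSlopes T b).encard = 2 := by
  obtain ⟨N, hN⟩ := F.exists_slope_bound hT T b
  have hover : ∀ k, N < |k| → T ∈ F.D k → b < F.u k T := fun k hk hkD ↦
    lt_of_not_ge fun h ↦ (hN T ⟨le_rfl, le_rfl⟩ k hkD h).not_gt hk
  have hmN : |m| ≤ N := hN T ⟨le_rfl, le_rfl⟩ m hTD hlt.le
  have hN0 : 0 ≤ N := (abs_nonneg m).trans hmN
  have habs : N < |N + 1| := by rw [abs_of_nonneg (by linarith)]; linarith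
  obtain ⟨m₂, hm₂, h₂⟩ := F.inter_hittingSlopes_nonempty isPreconnected_Iic hT.le self_mem_Iic
    hTD hlt (mem_Iic.2 (by linarith [neg_abs_le m])) (hover (-(N + 1)) (by rwa [abs_neg]))
  obtain ⟨m₁, hm₁, h₁⟩ := F.inter_hittingSlopes_nonempty isPreconnected_Ici hT.le self_mem_Ici
    hTD hlt (mem_Ici.2 (by linarith [le_abs_self m])) (hover (N + 1) habs)
  have hmem : m ∉ F.hittingSlopes T b := fun h ↦ hlt.ne h.2
  have hm₂m : m₂ < m := lt_of_le_of_ne hm₂ fun h ↦ hmem (h ▸ h₂)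
  have hmm₁ : m < m₁ := lt_of_le_of_ne hm₁ fun h ↦ hmem (h ▸ h₁)
  have hthird : ∀ k₁ ∈ F.hittingSlopes T b, ∀ k₂ ∈ F.hittingSlopes T b,
      ∀ k₃ ∈ F.hittingSlopes T b, k₁ < k₂ → ¬k₂ < k₃ := fun k₁ hk₁ k₂ hk₂ k₃ hk₃ h₁₂ h₂₃ ↦
    (F.lt_of_between_hittingSlopes hT hk₁ hk₃ h₁₂ h₂₃).2.ne hk₂.2
  have hpair : F.hittingSlopes T b = {m₂, m₁} := by
    refine Subset.antisymm (fun k hk ↦ ?_) (pair_subset h₂ h₁)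
    rcases lt_trichotomy k m₂ with hk₂ | rfl | hk₂
    · exact absurd (hm₂m.trans hmm₁) (hthird k hk m₂ h₂ m₁ h₁ hk₂)
    · exact mem_insert _ _
    rcases lt_trichotomy k m₁ with hk₁ | rfl | hk₁
    · exact absurd hk₁ (hthird m₂ h₂ k hk m₁ h₁ hk₂)
    · exact mem_insert_of_mem _ rfl
    · exact absurd hk₁ (hthird m₂ h₂ m₁ h₁ k hk (hm₂m.trans hmm₁))
  rw [hpair, encard_pair (hm₂m.trans hmm₁).ne]

theorem exists_last_time (b : ℝ) : ∃ T₀ > 0, (∃ m, T₀ ∈ F.D m ∧ F.u m T₀ ≤ b) ∧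
    ∀ m T, T ∈ F.D m → F.u m T ≤ b → T ≤ T₀ := by
  obtain ⟨m₁, t, ht, htD, hlt⟩ := F.exists_lt one_pos b
  obtain ⟨T₁, hT₁, hT₁D, hT₁b⟩ := F.exists_eq_of_lt ht.1 htD hlt
  have hT₁0 : 0 < T₁ := ht.1.trans_lt hT₁
  obtain ⟨T₂, hT₂⟩ := F.exists_time_bound b
  obtain ⟨N, hN⟩ := F.exists_slope_bound hT₁0 T₂ b
  have hcompact : IsCompact ((Icc (-N) N ×ˢ Icc T₁ T₂) ∩
      {z : ℝ × ℝ | 0 ≤ z.2 ∧ z.2 ∈ F.D z.1 ∧ F.u z.1 z.2 ≤ b}) :=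
    (isCompact_Icc.prod isCompact_Icc).inter_right (F.isClosed_setOf_le b)
  have hmem : ∀ m T, T₁ ≤ T → T ∈ F.D m → F.u m T ≤ b → (m, T) ∈ (Icc (-N) N ×ˢ Icc T₁ T₂) ∩
      {z : ℝ × ℝ | 0 ≤ z.2 ∧ z.2 ∈ F.D z.1 ∧ F.u z.1 z.2 ≤ b} := fun m T hT hTD hb ↦
    have hTI : T ∈ Icc T₁ T₂ := ⟨hT, hT₂ T m hTD hb⟩
    ⟨⟨abs_le.1 (hN T hTI m hTD hb), hTI⟩, hT₁0.le.trans hT, hTD, hb⟩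
  obtain ⟨⟨m₀, T₀⟩, ⟨⟨-, hT₀⟩, -, hT₀D, hT₀b⟩, hmax⟩ := hcompact.exists_isMaxOn
    ⟨_, hmem m₁ T₁ le_rfl hT₁D hT₁b.le⟩ continuous_snd.continuousOn
  refine ⟨T₀, hT₁0.trans_le hT₀.1, ⟨m₀, hT₀D, hT₀b⟩, fun m T hTD hb ↦ ?_⟩
  rcases le_total T T₁ with hT | hT
  · exact hT.trans hT₀.1
  · exact hmax (hmem m T hT hTD hb)

theorem exists_threshold (b : ℝ) : ∃ T₀ > 0, (∀ T > T₀, F.hittingSlopes T b = ∅) ∧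
    (F.hittingSlopes T₀ b).encard = 1 ∧ ∀ T ∈ Ioo 0 T₀, (F.hittingSlopes T b).encard = 2 := by
  obtain ⟨T₀, hT₀, ⟨m₀, hm₀D, hm₀b⟩, hmax⟩ := F.exists_last_time b
  have hge : ∀ m, T₀ ∈ F.D m → b ≤ F.u m T₀ := fun m hD ↦ by
    by_contra! hlt
    obtain ⟨T, hT, hTD, hTb⟩ := F.exists_eq_of_lt hT₀.le hD hlt
    exact (hmax m T hTD hTb.le).not_gt hT
  have hm₀ : m₀ ∈ F.hittingSlopes T₀ b := ⟨hm₀D, hm₀b.antisymm (hge m₀ hm₀D)⟩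
  refine ⟨T₀, hT₀, fun T hT ↦ ?_, ?_, fun T hT ↦ ?_⟩
  · exact eq_empty_of_forall_notMem fun m hm ↦ (hmax m T hm.1 hm.2.le).not_gt hT
  · exact encard_eq_one.2 ⟨m₀, (F.hittingSlopes_subsingleton hT₀ hge).eq_singleton_of_mem hm₀⟩
  · obtain ⟨m, hTD, hlt⟩ := F.exists_undershoot hT.1 hT.2 hm₀.1 hm₀.2
    exact F.encard_hittingSlopes_eq_two hT.1 hTD hlt

/-! ### Back to the first Painlevé equation -/

/-- The solutions through `(x₀, y₀)`, continued to the left, in the variable `t = x₀ - x`. -/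
noncomputable def ofP1 (x₀ y₀ : ℝ) (hx₀ : x₀ ≤ 0) : ShootingFamily (-x₀) y₀ where
  D m := {t | x₀ - t ∈ (P1Solution.ofCauchyData x₀ y₀ (-m)).dom}
  u m t := (P1Solution.ofCauchyData x₀ y₀ (-m)).toFun (x₀ - t)
  v m t := -deriv (P1Solution.ofCauchyData x₀ y₀ (-m)).toFun (x₀ - t)
  c_nonneg := neg_nonneg.2 hx₀
  isOpen_D m := (P1Solution.isOpen_dom _).preimage (continuous_sub_left x₀)
  ordConnected_D m := ⟨fun _ hs _ ht _ hz ↦ (P1Solution.ordConnected_dom _).out ht hs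
    ⟨sub_le_sub_left hz.2 x₀, sub_le_sub_left hz.1 x₀⟩⟩
  zero_mem m := by simpa using (P1Solution.ofCauchyData_spec x₀ y₀ (-m)).mem
  u_zero m := by simpa using (P1Solution.ofCauchyData_spec x₀ y₀ (-m)).apply_eq
  v_zero m := by simpa using congrArg Neg.neg (P1Solution.ofCauchyData_spec x₀ y₀ (-m)).deriv_eq
  solves m :=
    { hasDerivAt := fun t ht ↦ ((P1Solution.satisfies _).hasDerivAt ht).comp_const_sub x₀ t
      hasDerivAt_deriv := fun t ht ↦
        (((P1Solution.satisfies _ _ ht).2.comp_const_sub x₀ t).neg).congr_deriv (by ring) }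
  closure_subset m s K hs hK := by
    have hclosure := P1Solution.closure_subset_dom _ (image_subset_iff.2 hs)
      (forall_mem_image.2 fun t ht ↦ (by simpa only [abs_neg] using hK t ht))
    exact image_subset_iff.1 ((image_closure_subset_closure_image
      (continuous_sub_left x₀)).trans hclosure)

end ShootingFamily

theorem injective_ofCauchyData_neg (x₀ y₀ : ℝ) :
    Function.Injective fun m ↦ P1Solution.ofCauchyData x₀ y₀ (-m) := fun m m' h ↦ by
  have hderiv := congrArg (fun y : P1Solution ↦ deriv y.toFun x₀) h
  simpa [(P1Solution.ofCauchyData_spec _ _ _).deriv_eq] using hderiv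

theorem P1DirichletSolutions_eq_image {x₀ : ℝ} (hx₀ : x₀ ≤ 0) (y₀ x₁ b : ℝ) :
    P1DirichletSolutions x₀ y₀ x₁ b = (fun m ↦ P1Solution.ofCauchyData x₀ y₀ (-m)) ''
      (ShootingFamily.ofP1 x₀ y₀ hx₀).hittingSlopes (x₀ - x₁) b := by
  ext y
  simp only [ShootingFamily.hittingSlopes, ShootingFamily.ofP1, mem_image, mem_ofPred_eq,
    sub_sub_cancel]
  constructor
  · rintro ⟨⟨hdom, rfl⟩, hy₁⟩
    refine ⟨-deriv y.toFun x₀, ?_⟩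
    rw [neg_neg, ← y.eq_ofCauchyData hdom]
    exact ⟨hy₁, rfl⟩
  · rintro ⟨m, hm, rfl⟩
    have hspec := P1Solution.ofCauchyData_spec x₀ y₀ (-m)
    exact ⟨⟨hspec.mem, hspec.apply_eq⟩, hm⟩

theorem encard_P1DirichletSolutions {x₀ : ℝ} (hx₀ : x₀ ≤ 0) (y₀ x₁ b : ℝ) :
    (P1DirichletSolutions x₀ y₀ x₁ b).encard =
      ((ShootingFamily.ofP1 x₀ y₀ hx₀).hittingSlopes (x₀ - x₁) b).encard := by
  rw [P1DirichletSolutions_eq_image hx₀, (injective_ofCauchyData_neg x₀ y₀).encard_image]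

/-- Here `b` is the left boundary value. The first two clauses say that the infimum `P1Z x₀ y₀ b`
is a genuine one (of a nonempty set bounded below), and that it lies to the left of `x₀`. -/
theorem theorem7p2 (x₀ y₀ b : ℝ) (hx₀ : x₀ ≤ 0) :
    IsGLB (P1LevelAbscissas x₀ y₀ b) (P1Z x₀ y₀ b) ∧
    P1Z x₀ y₀ b < x₀ ∧
    ∀ x₁ : ℝ, x₁ < x₀ →
      (x₁ < P1Z x₀ y₀ b → P1DirichletSolutions x₀ y₀ x₁ b = ∅) ∧
      (x₁ = P1Z x₀ y₀ b → ∃! y : P1Solution, y ∈ P1DirichletSolutions x₀ y₀ x₁ b) ∧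
      (P1Z x₀ y₀ b < x₁ → (P1DirichletSolutions x₀ y₀ x₁ b).encard = 2) := by
  obtain ⟨T₀, hT₀, hnone, hone, htwo⟩ := (ShootingFamily.ofP1 x₀ y₀ hx₀).exists_threshold b
  have hempty : ∀ x₁ < x₀ - T₀, P1DirichletSolutions x₀ y₀ x₁ b = ∅ := fun x₁ hlt ↦ by
    rw [P1DirichletSolutions_eq_image hx₀, hnone _ (by linarith), image_empty]
  have hunique : ∃ y, P1DirichletSolutions x₀ y₀ (x₀ - T₀) b = {y} := by
    rwa [← encard_eq_one, encard_P1DirichletSolutions hx₀, sub_sub_cancel]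
  obtain ⟨y, hy⟩ := hunique
  have hleast : IsLeast (P1LevelAbscissas x₀ y₀ b) (x₀ - T₀) :=
    ⟨⟨y, hy.ge rfl⟩, fun x₁ ⟨z, hz⟩ ↦ not_lt.1 fun hlt ↦ (hempty x₁ hlt).subset hz⟩
  rw [P1Z, hleast.csInf_eq]
  refine ⟨hleast.isGLB, sub_lt_self x₀ hT₀, fun x₁ hx₁ ↦ ⟨hempty x₁, ?_, fun hlt ↦ ?_⟩⟩
  · rintro rfl
    exact ⟨y, hy.ge rfl, fun z hz ↦ hy.le hz⟩
  · rw [encard_P1DirichletSolutions hx₀]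
    exact htwo _ ⟨by linarith, by linarith⟩
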